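/- Fix a depth $p$ and a probability distribution $\mathbf w$ on $\mathbb R$ with finite second moment and mean $\mu=\mathbb E_{\mathbf w}[w]\neq 0$. For a finite graph $G=(V,E)$ with edge weights $(w_e)_{e\in E}$ let $$C=\tfrac12\sum_{\{u,v\}\in E}w_{uv}(1-Z_uZ_v),\qquad B=\sum_{v\in V}X_v,$$ $$|\boldsymbol\gamma,\boldsymbol\beta\rangle=e^{-i\beta_pB}e^{-i\gamma_pC}\cdots e^{-i\beta_1B}e^{-i\gamma_1C}|+\rangle^{\otimes V},\qquad \langle C(\boldsymbol\gamma,\boldsymbol\beta)\rangle=\langle\boldsymbol\gamma,\boldsymbol\beta|C|\boldsymbol\gamma,\boldsymbol\beta\rangle$$ for $\boldsymbol\gamma,\boldsymbol\beta\in\mathbb R^p$, and write $|\boldsymbol\gamma,\boldsymbol\beta\rangle_{\mathrm u}$ for this state when all weights equal $1$. For a finite nonempty $(D+1)$-regular graph $G$ of girth $>2p+1$, with edge weights drawn i.i.d. from $\mathbf w$, define $\vartheta_p(D,\boldsymbol\gamma,\boldsymbol\beta)$ by $$\frac{\mathbb E_{\mathbf w}[\langle C(\boldsymbol\gamma,\boldsymbol\beta)\rangle]}{\mathbb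 E_{\mathbf w}\big[\sum_{e\in E}w_e\big]}=\frac12+\frac{\vartheta_p(D,\boldsymbol\gamma,\boldsymbol\beta)}{\sqrt D}.$$ Then the expectations below exist, and for all $\boldsymbol\gamma,\boldsymbol\beta\in\mathbb R^p$ the limits $$\nu_p(\boldsymbol\gamma,\boldsymbol\beta)=\lim_{D\to\infty}-\tfrac{\sqrt D}{2}\,{}_{\mathrm u}\big\langle\tfrac{\boldsymbol\gamma}{\sqrt D},\boldsymbol\beta\big|Z_LZ_R\big|\tfrac{\boldsymbol\gamma}{\sqrt D},\boldsymbol\beta\big\rangle_{\mathrm u},$$ $$\vartheta_p(\boldsymbol\gamma,\boldsymbol\beta)=\lim_{D\to\infty}\vartheta_p\big(D,\tfrac{\boldsymbol\gamma}{\sqrt D},\boldsymbol\beta\big)=\lim_{D\to\infty}-\tfrac{\sqrt D}{2\mu}\,\mathbb E_{\mathbf w}\Big[w_{LR}\big\langle\tfrac{\boldsymbol\gamma}{\sqrt D},\boldsymbol\beta\big|Z_LZ_R\big|\tfrac{\boldsymbol\gamma}{\sqrt D},\boldsymbol\beta\big\rangle\Big]$$ exist, uniformly over the choice of the $(D+1)$-regular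 graph of girth $>2p+1$ and of its edge $\{L,R\}$ (so $\nu_p$ depends only on $p$, and $\vartheta_p$ only on $p$ and $\mathbf w$), and $$\nu_p(\boldsymbol\gamma,\boldsymbol\beta)=\frac{\mu}{\sqrt{\mathbb E_{\mathbf w}[w^2]}}\;\vartheta_p\!\left(\frac{\boldsymbol\gamma}{\sqrt{\mathbb E_{\mathbf w}[w^2]}},\boldsymbol\beta\right).$$ -/

import Mathlib

open MeasureTheory Filter Topology

universe u

namespace QAOA

noncomputable section

/-- Computational basis labels: an assignment of a spin `±1` (a unit of `ℤ`) to every vertex. -/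
abbrev Config (V : Type u) : Type u := V → ℤˣ

/-- Operators on the qubits indexed by `V`, in the computational basis. -/
abbrev Op (V : Type u) : Type u := Matrix (Config V) (Config V) ℂ

section Operators

variable {V : Type u} [Fintype V] [DecidableEq V]

/-- The Pauli operator `Z` on qubit `v`: `Z_v |z⟩ = z_v |z⟩`. -/
def pauliZ (v : V) : Op V := Matrix.diagonal fun z => ((z v : ℤ) : ℂ)

/-- The Pauli operator `X` on qubit `v`: it flips the spin at `v`. -/
def pauliX (v : V) : Op V :=
  Matrix.of fun z z' => if z = Function.update z' v (-z' v) then 1 else 0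

theorem pauliZ_mul_comm (u v : V) : pauliZ u * pauliZ v = pauliZ v * pauliZ u := by
  simp [pauliZ, Matrix.diagonal_mul_diagonal, mul_comm]

/-- The operator `Z_u Z_v` attached to the unordered pair `{u, v}`. -/
def pauliZZ : Sym2 V → Op V :=
  Sym2.lift ⟨fun u v => pauliZ u * pauliZ v, pauliZ_mul_comm⟩

variable (G : SimpleGraph V) [DecidableRel G.Adj]

/-- The weighted MaxCut Hamiltonian `C = (1/2) ∑_{{u,v} ∈ E} w_{uv} (1 - Z_u Z_v)`. -/
def maxCutHamiltonian (w : G.edgeSet → ℝ) : Op V :=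
  (1 / 2 : ℂ) • ∑ e : G.edgeSet, (w e : ℂ) • (1 - pauliZZ (e : Sym2 V))

/-- The transverse-field mixer `B = ∑_v X_v`. -/
def mixer (V : Type u) [Fintype V] [DecidableEq V] : Op V := ∑ v : V, pauliX v

/-- The uniform superposition `|s⟩ = |+⟩^{⊗ V}`. -/
def plusState (V : Type u) [Fintype V] [DecidableEq V] : Config V → ℂ :=
  fun _ => ((1 / Real.sqrt (Fintype.card (Config V)) : ℝ) : ℂ)

/-- The `p`-layer QAOA state
`e^{-iβ_p B} e^{-iγ_p C} ⋯ e^{-iβ_1 B} e^{-iγ_1 C} |s⟩` for the edge weights `w`. -/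
def state (w : G.edgeSet → ℝ) : (p : ℕ) → (γ β : Fin p → ℝ) → Config V → ℂ
  | 0, _, _ => plusState V
  | p + 1, γ, β =>
      Matrix.mulVec (NormedSpace.exp ((-Complex.I * (β (Fin.last p) : ℂ)) • mixer V))
        (Matrix.mulVec
          (NormedSpace.exp ((-Complex.I * (γ (Fin.last p) : ℂ)) • maxCutHamiltonian G w))
          (state w p (Fin.init γ) (Fin.init β)))

/-- The expectation `⟨γ, β| A |γ, β⟩` of an observable `A` in the QAOA state
(a real number when `A` is Hermitian). -/
def expect (w : G.edgeSet → ℝ) {p : ℕ} (γ β : Fin p → ℝ) (A : Op V) : ℝ :=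
  (star (state G w p γ β) ⬝ᵥ Matrix.mulVec A (state G w p γ β)).re

/-- The QAOA energy `⟨C(γ, β)⟩` for the edge weights `w`. -/
def energy (w : G.edgeSet → ℝ) {p : ℕ} (γ β : Fin p → ℝ) : ℝ :=
  expect G w γ β (maxCutHamiltonian G w)

/-- The joint law of edge weights drawn independently from `law`. -/
def weightLaw (law : Measure ℝ) : Measure (G.edgeSet → ℝ) := Measure.pi fun _ => law

/-- `E_w[⟨C(γ, β)⟩] / E_w[∑_e w_e]`, the generalized cut fraction. -/
def cutFraction (law : Measure ℝ) {p : ℕ} (γ β : Fin p → ℝ) : ℝ :=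
  (∫ w, energy G w γ β ∂(weightLaw G law)) / (∫ w, ∑ e : G.edgeSet, w e ∂(weightLaw G law))

/-- `E_w[w_e ⟨γ, β| Z_L Z_R |γ, β⟩]` for the edge `e = {L, R}`. -/
def edgeCorrelation (law : Measure ℝ) {p : ℕ} (γ β : Fin p → ℝ) (e : G.edgeSet) : ℝ :=
  ∫ w, w e * expect G w γ β (pauliZZ (e : Sym2 V)) ∂(weightLaw G law)

end Operators

/-- A finite `(D+1)`-regular graph of girth larger than `2p+1`, with a distinguished edge.
(The girth is the extended one, so it is infinite for acyclic graphs.) -/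
structure MarkedGraph (p : ℕ) : Type (u + 1) where
  V : Type u
  [fintypeV : Fintype V]
  [decEqV : DecidableEq V]
  G : SimpleGraph V
  [decAdj : DecidableRel G.Adj]
  D : ℕ
  regular : G.IsRegularOfDegree (D + 1)
  girth_gt : ((2 * p + 1 : ℕ) : ℕ∞) < G.egirth
  edge : G.edgeSet

attribute [instance] MarkedGraph.fintypeV MarkedGraph.decEqV MarkedGraph.decAdj

/-- The filter expressing `D → ∞`, uniformly over all graphs in `MarkedGraph p`
and all choices of an edge. -/
def degreeToInfinity (p : ℕ) : Filter (MarkedGraph.{u} p) := comap (fun S => S.D) atTop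

/-- `ϑ_p(D, γ, β)`, defined by
`E_w[⟨C(γ, β)⟩] / E_w[∑_e w_e] = 1/2 + ϑ_p(D, γ, β) / √D`. -/
def theta (law : Measure ℝ) {p : ℕ} (S : MarkedGraph.{u} p) (γ β : Fin p → ℝ) : ℝ :=
  √(S.D : ℝ) * (cutFraction S.G law γ β - 1 / 2)

/-- The same quantity computed from one edge `{L, R}`:
`-(√D / (2μ)) E_w[w_{LR} ⟨γ, β| Z_L Z_R |γ, β⟩]`. -/
def thetaEdge (law : Measure ℝ) {p : ℕ} (S : MarkedGraph.{u} p) (γ β : Fin p → ℝ) : ℝ :=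
  -(√(S.D : ℝ) / (2 * ∫ x, x ∂law)) * edgeCorrelation S.G law γ β S.edge

/-- The unweighted quantity `-(√D / 2) ⟨γ, β| Z_L Z_R |γ, β⟩` (all edge weights are `1`). -/
def nuEdge {p : ℕ} (S : MarkedGraph.{u} p) (γ β : Fin p → ℝ) : ℝ :=
  -(√(S.D : ℝ) / 2) * expect S.G (fun _ => 1) γ β (pauliZZ (S.edge : Sym2 S.V))

/-- `ν` is the limit, as `D → ∞`, of the unweighted quantity at `(γ/√D, β)`. -/
def IsUnweightedLimit (p : ℕ) (ν : (Fin p → ℝ) → (Fin p → ℝ) → ℝ) : Prop :=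
  ∀ γ β : Fin p → ℝ,
    Tendsto (fun S : MarkedGraph.{u} p => nuEdge S (fun r => γ r / √(S.D : ℝ)) β)
      (degreeToInfinity p) (𝓝 (ν γ β))

/-- `ϑ` is the limit, as `D → ∞`, of `ϑ_p(D, γ/√D, β)`, computed either from the
whole energy or from an arbitrary edge; the expectations involved exist. -/
def IsWeightedLimit (law : Measure ℝ) (p : ℕ) (ϑ : (Fin p → ℝ) → (Fin p → ℝ) → ℝ) : Prop :=
  (∀ (S : MarkedGraph.{u} p) (γ β : Fin p → ℝ),
    Integrable (fun w => energy S.G w γ β) (weightLaw S.G law) ∧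
    Integrable (fun w => w S.edge * expect S.G w γ β (pauliZZ (S.edge : Sym2 S.V)))
      (weightLaw S.G law)) ∧
  ∀ γ β : Fin p → ℝ,
    Tendsto (fun S : MarkedGraph.{u} p => theta law S (fun r => γ r / √(S.D : ℝ)) β)
      (degreeToInfinity p) (𝓝 (ϑ γ β)) ∧
    Tendsto (fun S : MarkedGraph.{u} p => thetaEdge law S (fun r => γ r / √(S.D : ℝ)) β)
      (degreeToInfinity p) (𝓝 (ϑ γ β))

end

end QAOA

/-! Inserting the computational basis between all layers turns `⟨Z_L Z_R⟩` into a sum over histories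
`σ : V → Site p`, with one weight per qubit and one phase `e^{iwt/2}` per edge
(`expect_pauliZZ_eq`). In the Heisenberg picture only the edges in the light cone of `{L, R}` matter
(`expect_congr`), so all other weights may be set to zero. Large girth makes the remaining edges a
tree (`exists_levels_parents`). Independence averages the phases edge by edge, and summing from the
leaves inwards gives `treeCorrelation`, which depends only on `D`, the law and the angles
(`weight_mul_expect`). This yields uniformity over graphs and edges; and since all edges contribute
equally, the energy and the single-edge forms of `ϑ` coincide (`theta_eq`).

For the limit, put `κ = E[w²]`. Flipping all spins in one qubit's history preserves its weight and
its branches and reverses its edge phases. So a tree edge contributes only the even part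
`E[cos(wt/(2√D))] = 1 - κt²/(8D) + o(1/D)`. Unitarity normalizes the branches
(`sum_siteWeight_mul_branch`), so their `D`-th powers converge to exponentials (`tendsto_branch`).
The observable is odd under the flip, so the central edge contributes only the odd part of `E[w
e^{iwt/(2√D)}]`, which times `√D` tends to `iκt/2`.

Hence the law enters only through `μ` and `κ`. The limiting branches depend on `γ` through `κγ²` and
the central factor is linear in `γ`, so replacing `γ` by `γ/√κ` reduces to `κ = 1`
(`limitCorrelation_scale`). The unweighted case is the law `δ_1`. -/

namespace QAOA

noncomputable section

open Finset Matrix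

/-! ### Matrix entries of the two kinds of layers -/

section Exponentials

section Flip

variable {V : Type u} [DecidableEq V]

/-- Flipping the spin at `v`. -/
def flip (v : V) (z : Config V) : Config V := Function.update z v (-z v)

theorem flip_flip (v : V) (z : Config V) : flip v (flip v z) = z := by
  simp [flip]

theorem eq_flip_iff (v : V) (z z' : Config V) : z = flip v z' ↔ z' = flip v z :=
  ⟨fun h => by rw [h, flip_flip], fun h => by rw [h, flip_flip]⟩

end Flip

variable {V : Type u} [Fintype V] [DecidableEq V]

theorem pauliX_mul_apply (v : V) (A : Op V) (z z' : Config V) :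
    (pauliX v * A) z z' = A (flip v z) z' := by
  have h (y : Config V) : (pauliX v : Op V) z y = if y = flip v z then 1 else 0 := by
    simp only [pauliX, Matrix.of_apply]
    exact if_congr (eq_flip_iff v z y) rfl rfl
  simp [Matrix.mul_apply, h]

theorem mul_pauliX_apply (v : V) (A : Op V) (z z' : Config V) :
    (A * pauliX v) z z' = A z (flip v z') := by
  have h (y : Config V) : (pauliX v : Op V) y z' = if y = flip v z' then 1 else 0 := rfl
  simp [Matrix.mul_apply, h]

theorem pauliX_mul_self (v : V) : pauliX v * pauliX v = (1 : Op V) := by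
  ext z z'
  rw [pauliX_mul_apply]
  change (if flip v z = flip v z' then (1 : ℂ) else 0) = _
  rw [Matrix.one_apply]
  refine if_congr ?_ rfl rfl
  rw [eq_flip_iff, flip_flip, eq_comm]

theorem commute_pauliX (u v : V) : Commute (pauliX u : Op V) (pauliX v) := by
  by_cases huv : u = v
  · subst huv; exact Commute.refl _
  ext z z'
  rw [pauliX_mul_apply, mul_pauliX_apply]
  change (if flip u z = flip v z' then (1 : ℂ) else 0) = if z = flip v (flip u z') then 1 else 0
  have hc : flip v (flip u z') = flip u (flip v z') := by
    simp [flip, Function.update_of_ne huv, Function.update_of_ne (Ne.symm huv),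
      Function.update_comm huv]
  refine if_congr ?_ rfl rfl
  rw [hc, eq_flip_iff u, eq_comm]

theorem exp_smul_pauliX (β : ℝ) (v : V) :
    NormedSpace.exp ((-Complex.I * (β : ℂ)) • pauliX v)
      = ((Real.cos β : ℂ)) • (1 : Op V) + (-Complex.I * (Real.sin β : ℂ)) • pauliX v := by
  have hexp (A : Op V) : HasSum (fun n : ℕ => ((n.factorial : ℂ)⁻¹) • A ^ n)
      (NormedSpace.exp A) := by
    let _ : NormedRing (Op V) := Matrix.linftyOpNormedRing
    let _ : NormedAlgebra ℂ (Op V) := Matrix.linftyOpNormedAlgebra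
    exact NormedSpace.exp_series_hasSum_exp' (𝕂 := ℂ) A
  refine (hexp _).unique ?_
  have hev (k : ℕ) : (pauliX v : Op V) ^ (2 * k) = 1 := by
    rw [pow_mul, sq, pauliX_mul_self, one_pow]
  have hI (k : ℕ) : (-Complex.I) ^ (2 * k) = (-1) ^ k := by
    rw [pow_mul, sq]; simp
  -- Since `X² = 1`, the even powers sum to the cosine and the odd ones to the sine.
  refine HasSum.even_add_odd ?_ ?_
  · have := ((Complex.hasSum_cos (β : ℂ))).smul_const (1 : Op V)
    rw [Complex.ofReal_cos]
    convert this using 2 with k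
    rw [smul_pow, hev, smul_smul, mul_pow, hI]
    congr 1
    field_simp
  · have := ((Complex.hasSum_sin (β : ℂ)).mul_left (-Complex.I)).smul_const (pauliX v : Op V)
    rw [Complex.ofReal_sin]
    convert this using 2 with k
    rw [smul_pow, pow_succ (pauliX v), hev, one_mul, smul_smul, mul_pow, pow_succ (-Complex.I), hI]
    congr 1
    field_simp

/-- The matrix entries of `e^{-iβX}` on a single qubit. -/
def mixEntry (β : ℝ) (x y : ℤˣ) : ℂ :=
  if x = y then (Real.cos β : ℂ) else -Complex.I * (Real.sin β : ℂ)

theorem mixEntry_neg (β : ℝ) (x y : ℤˣ) : mixEntry β (-x) (-y) = mixEntry β x y := by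
  simp [mixEntry]

/-- Unitarity of `e^{-iβX}`; every later cancellation between bra and ket histories comes from it.
-/
theorem sum_mixEntry (β : ℝ) (y z : ℤˣ) :
    ∑ x, star (mixEntry β x y) * mixEntry β x z = if y = z then 1 else 0 := by
  have h : (Real.cos β : ℂ) * Real.cos β + Real.sin β * Real.sin β = 1 := by
    have := Real.cos_sq_add_sin_sq β
    rw [sq, sq] at this
    exact_mod_cast this
  have hu : (Finset.univ : Finset ℤˣ) = {1, -1} := by decide
  rw [hu, Finset.sum_pair (by decide)]
  rcases Int.units_eq_one_or y with rfl | rfl <;> rcases Int.units_eq_one_or z with rfl | rfl <;>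
    simp [mixEntry, -Complex.ofReal_cos, -Complex.ofReal_sin]
  · linear_combination h - (Real.sin β : ℂ) ^ 2 * Complex.I_sq
  · ring
  · ring
  · linear_combination h - (Real.sin β : ℂ) ^ 2 * Complex.I_sq

/-- The commuting single-qubit exponentials factor. A general `s` permits induction, qubits outside
it contributing a Kronecker delta. -/
theorem exp_smul_sum_pauliX_apply (β : ℝ) (s : Finset V) (z z' : Config V) :
    NormedSpace.exp ((-Complex.I * (β : ℂ)) • ∑ v ∈ s, (pauliX v : Op V)) z z'
      = ∏ v, if v ∈ s then mixEntry β (z v) (z' v) else if z v = z' v then 1 else 0 := by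
  induction s using Finset.induction_on generalizing z z' with
  | empty =>
    simp only [Finset.sum_empty, smul_zero, NormedSpace.exp_zero, Finset.notMem_empty, if_false,
      Matrix.one_apply]
    rw [Finset.prod_ite_zero]
    simp [funext_iff]
  | insert u s hu ih =>
    rw [Finset.sum_insert hu, smul_add, Matrix.exp_add_of_commute, exp_smul_pauliX, add_mul,
      Matrix.add_apply, smul_mul_assoc, smul_mul_assoc, one_mul, Matrix.smul_apply,
      Matrix.smul_apply, pauliX_mul_apply, ih, ih]
    · rw [← Finset.mul_prod_erase _ _ (Finset.mem_univ u),
        ← Finset.mul_prod_erase _ _ (Finset.mem_univ u),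
        ← Finset.mul_prod_erase _ _ (Finset.mem_univ u)]
      have h1 : ∀ y : Config V, (∀ v, v ≠ u → y v = z v) →
          (∏ v ∈ Finset.univ.erase u, if v ∈ s then mixEntry β (y v) (z' v)
            else if y v = z' v then 1 else 0) =
          ∏ v ∈ Finset.univ.erase u, if v ∈ insert u s then mixEntry β (z v) (z' v)
            else if z v = z' v then 1 else 0 := by
        intro y hy
        refine Finset.prod_congr rfl fun v hv => ?_
        have hvu := Finset.ne_of_mem_erase hv
        simp [hy v hvu, hvu]
      rw [h1 z fun _ _ => rfl, h1 (flip u z) fun v hv => by simp [flip, hv]]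
      simp only [hu, if_false, Finset.mem_insert_self, if_true, smul_eq_mul, ← mul_assoc,
        ← add_mul]
      congr 1
      rcases Int.units_eq_one_or (z u) with h | h <;>
        rcases Int.units_eq_one_or (z' u) with h' | h' <;>
        simp [mixEntry, flip, h, h']
    · refine ((Commute.sum_right _ _ _ fun v _ => commute_pauliX u v).smul_left _).smul_right _

theorem exp_mixer_apply (β : ℝ) (z z' : Config V) :
    NormedSpace.exp ((-Complex.I * (β : ℂ)) • mixer V) z z' = ∏ v, mixEntry β (z v) (z' v) := by
  rw [mixer, exp_smul_sum_pauliX_apply]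
  simp

/-- The value of `Z_u Z_v` at a configuration, for an unordered pair `{u, v}`. -/
def pairSpin (z : Config V) : Sym2 V → ℤˣ :=
  Sym2.lift ⟨fun u v => z u * z v, fun _ _ => mul_comm _ _⟩

theorem pauliZZ_eq_diagonal (e : Sym2 V) :
    pauliZZ e = Matrix.diagonal fun z : Config V => ((pairSpin z e : ℤ) : ℂ) := by
  induction e with
  | h u v => simp [pauliZZ, pauliZ, pairSpin, Matrix.diagonal_mul_diagonal]

variable (G : SimpleGraph V) [DecidableRel G.Adj]

/-- The eigenvalue of the MaxCut Hamiltonian at a configuration. -/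
def cost (w : G.edgeSet → ℝ) (z : Config V) : ℝ :=
  ∑ e : G.edgeSet, w e / 2 * (1 - ((pairSpin z e : ℤ) : ℝ))

theorem maxCutHamiltonian_eq_diagonal (w : G.edgeSet → ℝ) :
    maxCutHamiltonian G w = Matrix.diagonal fun z => (cost G w z : ℂ) := by
  ext z z'
  by_cases h : z = z'
  · subst h
    simp only [maxCutHamiltonian, pauliZZ_eq_diagonal, cost, Matrix.smul_apply, Matrix.sum_apply,
      Matrix.sub_apply, Matrix.one_apply_eq, Matrix.diagonal_apply_eq, smul_eq_mul,
      Finset.mul_sum]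
    push_cast
    exact Finset.sum_congr rfl fun e _ => by ring
  · simp [maxCutHamiltonian, pauliZZ_eq_diagonal, Matrix.sum_apply, h]

theorem exp_cost_eq_diagonal (w : G.edgeSet → ℝ) (γ : ℝ) :
    NormedSpace.exp ((-Complex.I * (γ : ℂ)) • maxCutHamiltonian G w)
      = Matrix.diagonal fun z => Complex.exp (-Complex.I * γ * cost G w z) := by
  rw [maxCutHamiltonian_eq_diagonal, ← Matrix.diagonal_smul, Matrix.exp_diagonal]
  congr 1
  ext z
  rw [Pi.coe_exp, ← Complex.exp_eq_exp_ℂ]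
  simp

end Exponentials

/-! ### Path sum for the state -/

section PathSum

/-- The amplitude of the history `c`, followed by `x`, of a single qubit under the mixers. -/
def amplitude : (p : ℕ) → (Fin p → ℝ) → (Fin p → ℤˣ) → ℤˣ → ℂ
  | 0, _, _, _ => ((1 / √2 : ℝ) : ℂ)
  | p + 1, β, c, x => mixEntry (β (Fin.last p)) x (c (Fin.last p)) *
      amplitude p (Fin.init β) (Fin.init c) (c (Fin.last p))

variable {V : Type u} [Fintype V] [DecidableEq V]
variable (G : SimpleGraph V) [DecidableRel G.Adj]

theorem plusState_eq_prod (z : Config V) : plusState V z = ∏ _v : V, ((1 / √2 : ℝ) : ℂ) := by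
  rw [plusState, Finset.prod_const, ← Complex.ofReal_pow, Fintype.card_fun, Finset.card_univ]
  congr 1
  rw [Fintype.card_units_int, Nat.cast_pow, _root_.one_div_pow, Nat.cast_ofNat, Real.sqrt_eq_rpow,
    Real.sqrt_eq_rpow, Real.rpow_pow_comm (by norm_num)]

/-- `τ r` is the configuration seen by the `r`-th cost layer. Cost layers are diagonal and mixers
factor over qubits, so the mixer amplitudes regroup into one factor per qubit. -/
theorem state_eq_sum (w : G.edgeSet → ℝ) (p : ℕ) (γ β : Fin p → ℝ) (z : Config V) :
    state G w p γ β z = ∑ τ : Fin p → Config V,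
      (∏ v, amplitude p β (fun r => τ r v) (z v)) *
        ∏ r, Complex.exp (-Complex.I * γ r * cost G w (τ r)) := by
  induction p generalizing z with
  | zero => simp [state, amplitude, plusState_eq_prod]
  | succ p ih =>
    rw [state, exp_cost_eq_diagonal, ← (Fin.snocEquiv fun _ => Config V).sum_comp,
      Fintype.sum_prod_type, Matrix.mulVec, dotProduct]
    refine Finset.sum_congr rfl fun y _ => ?_
    rw [exp_mixer_apply, Matrix.mulVec_diagonal, ih, Finset.mul_sum, Finset.mul_sum]
    refine Finset.sum_congr rfl fun τ _ => ?_
    have h : ∀ v, amplitude (p + 1) β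
        (fun r => ((Fin.snocEquiv fun _ => Config V) (y, τ)) r v) (z v) =
          mixEntry (β (Fin.last p)) (z v) (y v) *
            amplitude p (Fin.init β) (fun r => τ r v) (y v) := by
      intro v
      simp [amplitude, Fin.snocEquiv, Fin.init_def]
    simp only [h, Fin.prod_univ_castSucc, Finset.prod_mul_distrib]
    simp [Fin.snocEquiv, Fin.init_def]
    ring

end PathSum

/-! ### Histories of one qubit: flip symmetry and causality -/

section SingleSite

/-- The histories of one qubit in the path sum of an expectation value: the bra history,
the ket history, and the spin seen by the observable. -/
abbrev Site (p : ℕ) : Type := (Fin p → ℤˣ) × (Fin p → ℤˣ) × ℤˣ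

/-- The mixer factor of one qubit in the path sum. -/
def siteWeight {p : ℕ} (β : Fin p → ℝ) (a : Site p) : ℂ :=
  star (amplitude p β a.1 a.2.2) * amplitude p β a.2.1 a.2.2

/-- The phase acquired along an edge joining qubits with histories `a` and `b`. -/
def sitePhase {p : ℕ} (γ : Fin p → ℝ) (a b : Site p) : ℝ :=
  ∑ r, γ r * (((a.2.1 r * b.2.1 r : ℤˣ) : ℤ) - ((a.1 r * b.1 r : ℤˣ) : ℤ))

theorem sitePhase_comm {p : ℕ} (γ : Fin p → ℝ) (a b : Site p) :
    sitePhase γ a b = sitePhase γ b a := by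
  simp only [sitePhase, mul_comm]

theorem sitePhase_neg_left {p : ℕ} (γ : Fin p → ℝ) (a b : Site p) :
    sitePhase γ (-a) b = -sitePhase γ a b := by
  simp only [sitePhase, ← Finset.sum_neg_distrib]
  refine Finset.sum_congr rfl fun r _ => ?_
  simp
  ring

theorem sitePhase_div {p : ℕ} (γ : Fin p → ℝ) (c : ℝ) (a b : Site p) :
    sitePhase (fun r => γ r / c) a b = sitePhase γ a b / c := by
  simp only [sitePhase, Finset.sum_div]
  exact Finset.sum_congr rfl fun r _ => by ring

theorem amplitude_neg (p : ℕ) (β : Fin p → ℝ) (c : Fin p → ℤˣ) (x : ℤˣ) :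
    amplitude p β (-c) (-x) = amplitude p β c x := by
  induction p generalizing x with
  | zero => rfl
  | succ p ih =>
    rw [amplitude, amplitude, Pi.neg_apply, mixEntry_neg]
    congr 1
    exact ih _ _ _

/-- Mixer entries see only whether two successive spins agree, hence the invariance under a flip of
the whole history. -/
theorem siteWeight_neg {p : ℕ} (β : Fin p → ℝ) (a : Site p) :
    siteWeight β (-a) = siteWeight β a := by
  simp [siteWeight, amplitude_neg]

/-- `h` does not distinguish histories whose bra and ket parts agree from some time on:
their common part can be deleted, and `h = 1` if they always agree. -/
def IsCausal : (p : ℕ) → ((Fin p → ℤˣ) → (Fin p → ℤˣ) → ℂ) → Prop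
  | 0, h => ∀ c d, h c d = 1
  | p + 1, h => ∃ h' : (Fin p → ℤˣ) → (Fin p → ℤˣ) → ℂ, IsCausal p h' ∧
      ∀ c d, c (Fin.last p) = d (Fin.last p) → h c d = h' (Fin.init c) (Fin.init d)

theorem isCausal_one (p : ℕ) : IsCausal p fun _ _ => 1 := by
  induction p with
  | zero => exact fun _ _ => rfl
  | succ p ih => exact ⟨_, ih, fun _ _ _ => rfl⟩

theorem IsCausal.pow {p : ℕ} {h : (Fin p → ℤˣ) → (Fin p → ℤˣ) → ℂ} (hh : IsCausal p h) (n : ℕ) :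
    IsCausal p fun c d => h c d ^ n := by
  induction p with
  | zero => exact fun c d => by simp only [hh c d, one_pow]
  | succ p ih =>
    obtain ⟨h', hc, he⟩ := hh
    exact ⟨_, ih hc, fun c d hcd => by simp only [he c d hcd]⟩

theorem sum_siteWeight_zero (β : Fin 0 → ℝ) (F : Site 0 → ℂ) (hF : ∀ a, F a = F default) :
    ∑ a, siteWeight β a * F a = F default := by
  have h2 : ((√2 : ℝ) : ℂ) * (√2 : ℝ) = 2 := by
    rw [← Complex.ofReal_mul, Real.mul_self_sqrt (by norm_num)]; norm_num
  have h3 : ((√2 : ℝ) : ℂ) ≠ 0 := by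
    intro h
    rw [h] at h2
    norm_num at h2
  have hcard : Fintype.card (Site 0) = 2 := by
    simp [Site]
  have hs : ∀ a : Site 0, siteWeight β a = 1 / 2 := by
    intro a
    simp only [siteWeight, amplitude]
    simp
    rw [← mul_inv, h2]
  simp only [hs, hF, Finset.sum_const, Finset.card_univ, hcard]
  simp

/-- Summing out the last layer of the history of a qubit. -/
theorem sum_siteWeight_succ {p : ℕ} (β : Fin (p + 1) → ℝ) (F : Site (p + 1) → ℂ)
    (F' : Site p → ℂ)
    (hF : ∀ a : Site (p + 1), a.1 (Fin.last p) = a.2.1 (Fin.last p) →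
      F a = F' (Fin.init a.1, Fin.init a.2.1, a.1 (Fin.last p)))
    (hF0 : ∀ c d x y, F (c, d, x) = F (c, d, y)) :
    ∑ a, siteWeight β a * F a = ∑ a, siteWeight (Fin.init β) a * F' a := by
  simp only [Site, Fintype.sum_prod_type]
  rw [← (Fin.snocEquiv fun _ => ℤˣ).sum_comp, Fintype.sum_prod_type, Finset.sum_comm]
  refine Finset.sum_congr rfl fun c _ => ?_
  simp_rw [← (Fin.snocEquiv fun _ => ℤˣ).sum_comp (fun d => ∑ x, siteWeight β (_, d, x) * _),
    Fintype.sum_prod_type]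
  rw [Finset.sum_congr rfl fun _ _ => Finset.sum_comm, Finset.sum_comm]
  refine Finset.sum_congr rfl fun d _ => ?_
  refine Finset.sum_congr rfl fun y _ => ?_
  let C : Fin (p + 1) → ℤˣ := Fin.snoc c y
  let E : ℤˣ → Fin (p + 1) → ℤˣ := fun y' => Fin.snoc d y'
  have key : ∀ y', ∑ x, siteWeight β (C, E y', x) *
      F (C, E y', x) =
      if y = y' then siteWeight (Fin.init β) (c, d, y) * F' (c, d, y) else 0 := by
    intro y'
    have h1 : ∀ x, siteWeight β (C, E y', x) *
      F (C, E y', x) =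
      (star (mixEntry (β (Fin.last p)) x y) * mixEntry (β (Fin.last p)) x y') *
      (star (amplitude p (Fin.init β) c y) * amplitude p (Fin.init β) d y' *
        F (C, E y', y)) := by
      intro x
      rw [hF0 _ _ x y]
      simp only [C, E, siteWeight, amplitude, Fin.snoc_last, Fin.init_snoc, star_mul']
      ring
    -- Summing over the observed spin `x` forces the last bra and ket spins to agree; the common
    -- value `y` becomes the observed spin at depth `p`.
    rw [Finset.sum_congr rfl fun x _ => h1 x, ← Finset.sum_mul, sum_mixEntry]
    split_ifs with hy
    · subst hy
      rw [one_mul, hF _ (by simp [C, E])]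
      simp [C, E, siteWeight]
    · rw [zero_mul]
  simp only [Fin.snocEquiv, Equiv.coe_fn_mk]
  exact (Finset.sum_congr rfl fun y' _ => key y').trans
    (by simp only [Finset.sum_ite_eq, Finset.mem_univ, if_true])

/-- Unitarity removes the layers from the last to the first, causality letting `h` follow at each
stage. -/
theorem IsCausal.sum_siteWeight {p : ℕ} {h : (Fin p → ℤˣ) → (Fin p → ℤˣ) → ℂ}
    (hh : IsCausal p h) (β : Fin p → ℝ) : ∑ a, siteWeight β a * h a.1 a.2.1 = 1 := by
  induction p with
  | zero =>
    rw [sum_siteWeight_zero _ _ fun a => by rw [hh, hh], hh]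
  | succ p ih =>
    obtain ⟨h', hc, he⟩ := hh
    rw [sum_siteWeight_succ β _ (fun a => h' a.1 a.2.1) (fun a ha => he _ _ ha)
      fun _ _ _ _ => rfl, ih hc]

theorem sum_siteWeight {p : ℕ} (β : Fin p → ℝ) : ∑ a, siteWeight β a = 1 := by
  simpa using (isCausal_one p).sum_siteWeight β

/-- Passing from children to their parent in the tree recursion preserves causality. If `c` and `d`
agree in the last layer, and unitarity makes the last spins of `b` agree, then the last term of the
phase cancels. The spin `x` is a dummy, as phases ignore the observed spin. -/
theorem IsCausal.transfer {p : ℕ} {h : (Fin p → ℤˣ) → (Fin p → ℤˣ) → ℂ} (hh : IsCausal p h)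
    (γ β : Fin p → ℝ) (g : ℝ → ℂ) (hg : g 0 = 1) (x : ℤˣ) :
    IsCausal p fun c d => ∑ b, siteWeight β b * (h b.1 b.2.1 * g (sitePhase γ (c, d, x) b)) := by
  induction p with
  | zero =>
    intro c d
    beta_reduce
    rw [sum_siteWeight_zero]
    · simp [sitePhase, hg, hh _ _]
    · intro a
      simp [sitePhase, hh _ _]
  | succ p ih =>
    obtain ⟨h', hc, he⟩ := hh
    refine ⟨_, ih hc (Fin.init γ) (Fin.init β), fun c d hcd => ?_⟩
    beta_reduce
    rw [sum_siteWeight_succ β _ (fun b => h' b.1 b.2.1 *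
      g (sitePhase (Fin.init γ) (Fin.init c, Fin.init d, x) b))]
    · intro a ha
      rw [he _ _ ha]
      congr 2
      simp [sitePhase, Fin.sum_univ_castSucc, hcd, ha, Fin.init_def]
    · intro _ _ _ _
      simp [sitePhase]

end SingleSite

/-! ### Path sum for the edge correlation -/

section PathSum

/-- The phase of an edge in the path sum. -/
def edgePhase {V : Type u} {p : ℕ} (γ : Fin p → ℝ) (σ : V → Site p) : Sym2 V → ℝ :=
  Sym2.lift ⟨fun u v => sitePhase γ (σ u) (σ v), fun _ _ => sitePhase_comm _ _ _⟩

/-- Trajectories of configurations and configurations of trajectories. -/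
def trajectoryEquiv (V : Type u) (p : ℕ) :
    (Fin p → Config V) × (Fin p → Config V) × Config V ≃ (V → Site p) where
  toFun t v := (fun r => t.1 r v, fun r => t.2.1 r v, t.2.2 v)
  invFun σ := (fun r v => (σ v).1 r, fun r v => (σ v).2.1 r, fun v => (σ v).2.2)
  left_inv _ := rfl
  right_inv _ := rfl

theorem edgePhase_trajectoryEquiv {V : Type u} {p : ℕ} (γ : Fin p → ℝ) (τ τ' : Fin p → Config V)
    (z : Config V) (e : Sym2 V) : edgePhase γ (trajectoryEquiv V p (τ, τ', z)) e =
      ∑ r, γ r * (((pairSpin (τ' r) e : ℤˣ) : ℤ) - ((pairSpin (τ r) e : ℤˣ) : ℤ)) := by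
  induction e with
  | h u v => rfl

variable {V : Type u} [Fintype V] [DecidableEq V]
variable (G : SimpleGraph V) [DecidableRel G.Adj]

/-- The path sum of `⟨γ, β| Z_u Z_v |γ, β⟩`. -/
def pathSum (w : G.edgeSet → ℝ) {p : ℕ} (γ β : Fin p → ℝ) (e : Sym2 V) : ℂ :=
  ∑ σ : V → Site p, (∏ v, siteWeight β (σ v)) *
    ((∏ e' : G.edgeSet, Complex.exp (Complex.I * (w e' / 2 * edgePhase γ σ e' : ℝ))) *
      ((pairSpin (fun v => (σ v).2.2) e : ℤ) : ℂ))

/-- Both bra and ket are expanded. The constants `w_e/2` in the cost cancel between the two, leaving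
only the difference of the spin products. -/
theorem expect_pauliZZ_eq (w : G.edgeSet → ℝ) {p : ℕ} (γ β : Fin p → ℝ) (e : Sym2 V) :
    expect G w γ β (pauliZZ e) = (pathSum G w γ β e).re := by
  rw [expect, pauliZZ_eq_diagonal, pathSum, ← (trajectoryEquiv V p).sum_comp]
  congr 1
  simp only [Fintype.sum_prod_type, dotProduct, Matrix.mulVec_diagonal, Pi.star_apply,
    state_eq_sum, star_sum, Finset.mul_sum]
  simp only [Finset.sum_mul]
  rw [Finset.sum_comm, Finset.sum_congr rfl fun _ _ => Finset.sum_comm, Finset.sum_comm]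
  refine Finset.sum_congr rfl fun τ _ => Finset.sum_congr rfl fun τ' _ =>
    Finset.sum_congr rfl fun z _ => ?_
  have h1 : ∏ v, siteWeight β (trajectoryEquiv V p (τ, τ', z) v) =
      star (∏ v, amplitude p β (fun r => τ r v) (z v)) *
        ∏ v, amplitude p β (fun r => τ' r v) (z v) := by
    rw [star_prod, ← Finset.prod_mul_distrib]
    rfl
  have h2 : ∏ e' : G.edgeSet, Complex.exp (Complex.I *
      (w e' / 2 * edgePhase γ (trajectoryEquiv V p (τ, τ', z)) e' : ℝ)) =
      star (∏ r, Complex.exp (-Complex.I * γ r * cost G w (τ r))) *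
        ∏ r, Complex.exp (-Complex.I * γ r * cost G w (τ' r)) := by
    simp only [← Complex.exp_sum, edgePhase_trajectoryEquiv, Complex.star_def,
      ← Complex.exp_conj, ← Complex.exp_add, map_sum, map_mul, map_neg, Complex.conj_I,
      Complex.conj_ofReal, cost]
    congr 1
    rw [← Finset.sum_add_distrib]
    push_cast
    simp only [Finset.mul_sum, ← Finset.sum_add_distrib]
    rw [Finset.sum_comm]
    refine Finset.sum_congr rfl fun r _ => Finset.sum_congr rfl fun e' _ => ?_
    ring
  have h3 : pairSpin (fun v => (trajectoryEquiv V p (τ, τ', z) v).2.2) e = pairSpin z e := rfl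
  rw [h1, h2, h3, star_mul']
  ring

end PathSum

/-! ### Heisenberg picture and the light cone -/

section LightCone

variable {V : Type u} [Fintype V] [DecidableEq V]

theorem conjTranspose_pauliX (v : V) : (pauliX v : Op V)ᴴ = pauliX v := by
  ext z z'
  simp only [Matrix.conjTranspose_apply]
  change star (if z' = flip v z then (1 : ℂ) else 0) = if z = flip v z' then 1 else 0
  rw [apply_ite star, star_one, star_zero]
  exact if_congr (eq_flip_iff _ _ _) rfl rfl

theorem conjTranspose_pauliZ {V : Type u} [Fintype V] (v : V) : (pauliZ v : Op V)ᴴ = pauliZ v := by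
  rw [pauliZ, Matrix.diagonal_conjTranspose]
  simp [Pi.star_def]

theorem conjTranspose_pauliZZ (e : Sym2 V) : (pauliZZ e : Op V)ᴴ = pauliZZ e := by
  simp [pauliZZ_eq_diagonal, Matrix.diagonal_conjTranspose, Pi.star_def]

theorem commute_pauliZ (u v : V) : Commute (pauliZ u : Op V) (pauliZ v) :=
  pauliZ_mul_comm u v

theorem commute_pauliZZ (e e' : Sym2 V) : Commute (pauliZZ e : Op V) (pauliZZ e') := by
  simp only [pauliZZ_eq_diagonal, Commute, SemiconjBy, Matrix.diagonal_mul_diagonal]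
  simp only [mul_comm]

theorem commute_pauliX_pauliZ {u v : V} (h : u ≠ v) :
    Commute (pauliX u : Op V) (pauliZ v) := by
  ext z z'
  rw [pauliX_mul_apply, mul_pauliX_apply]
  simp only [pauliZ, Matrix.diagonal_apply]
  have h1 : flip u z v = z v := by simp [flip, h.symm]
  rw [h1]
  refine if_congr ?_ rfl rfl
  rw [eq_flip_iff, eq_comm]

/-- The operator `A` acts as the identity on the qubits outside `S`. -/
def ActsOn (S : Set V) (A : Op V) : Prop :=
  ∀ v ∉ S, Commute A (pauliX v) ∧ Commute A (pauliZ v)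

namespace ActsOn

variable {S T : Set V} {A B : Op V}

theorem mono (h : ActsOn S A) (hST : S ⊆ T) : ActsOn T A :=
  fun v hv => h v fun h' => hv (hST h')

theorem mul (hA : ActsOn S A) (hB : ActsOn S B) : ActsOn S (A * B) :=
  fun v hv => ⟨(hA v hv).1.mul_left (hB v hv).1, (hA v hv).2.mul_left (hB v hv).2⟩

theorem smul (c : ℂ) (hA : ActsOn S A) : ActsOn S (c • A) :=
  fun v hv => ⟨(hA v hv).1.smul_left c, (hA v hv).2.smul_left c⟩

theorem sum {ι : Type*} (s : Finset ι) (F : ι → Op V) (hF : ∀ i ∈ s, ActsOn S (F i)) :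
    ActsOn S (∑ i ∈ s, F i) :=
  fun v hv => ⟨Commute.sum_left _ _ _ fun i hi => (hF i hi v hv).1,
    Commute.sum_left _ _ _ fun i hi => (hF i hi v hv).2⟩

theorem conjTranspose (hA : ActsOn S A) : ActsOn S Aᴴ := by
  intro v hv
  obtain ⟨h1, h2⟩ := hA v hv
  constructor
  · have := congrArg Matrix.conjTranspose h1.eq
    rw [Matrix.conjTranspose_mul, Matrix.conjTranspose_mul, conjTranspose_pauliX] at this
    exact this.symm
  · have := congrArg Matrix.conjTranspose h2.eq
    rw [Matrix.conjTranspose_mul, Matrix.conjTranspose_mul, conjTranspose_pauliZ] at this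
    exact this.symm

theorem exp (hA : ActsOn S A) : ActsOn S (NormedSpace.exp A) := by
  let _ : NormedRing (Op V) := Matrix.linftyOpNormedRing
  let _ : NormedAlgebra ℂ (Op V) := Matrix.linftyOpNormedAlgebra
  intro v hv
  exact ⟨(hA v hv).1.exp_left, (hA v hv).2.exp_left⟩

theorem pauliX {v : V} (hv : v ∈ S) : ActsOn S (pauliX v) := fun u hu =>
  ⟨commute_pauliX v u, commute_pauliX_pauliZ fun h => hu (h ▸ hv)⟩

theorem pauliZZ {e : Sym2 V} (he : ∀ v ∈ e, v ∈ S) : ActsOn S (pauliZZ e) := by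
  intro u hu
  induction e with
  | h x y =>
    have hx : u ≠ x := fun h => hu (h ▸ he x (by simp))
    have hy : u ≠ y := fun h => hu (h ▸ he y (by simp))
    exact ⟨((commute_pauliX_pauliZ hx).symm.mul_left (commute_pauliX_pauliZ hy).symm),
      (commute_pauliZ x u).mul_left (commute_pauliZ y u)⟩

theorem one_sub (hA : ActsOn S A) : ActsOn S (1 - A) := fun v hv =>
  ⟨(Commute.one_left _).sub_left (hA v hv).1, (Commute.one_left _).sub_left (hA v hv).2⟩

theorem commute_pauliZZ (hA : ActsOn S A) {e : Sym2 V} (he : ∀ v ∈ e, v ∉ S) :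
    Commute A (QAOA.pauliZZ e) := by
  induction e with
  | h x y => exact (hA x (he x (by simp))).2.mul_right (hA y (he y (by simp))).2

end ActsOn

/-- Conjugation by `e^{M + N}` ignores a skew-Hermitian `N` which commutes with everything. -/
theorem exp_add_conj {A M N : Op V} (hMN : Commute M N) (hN : Nᴴ = -N) (hA : Commute A N) :
    (NormedSpace.exp (M + N))ᴴ * A * NormedSpace.exp (M + N)
      = (NormedSpace.exp M)ᴴ * A * NormedSpace.exp M := by
  have h1 : NormedSpace.exp (M + N) = NormedSpace.exp N * NormedSpace.exp M := by
    rw [add_comm, Matrix.exp_add_of_commute _ _ hMN.symm]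
  have h2 : Commute A (NormedSpace.exp N) := by
    let _ : NormedRing (Op V) := Matrix.linftyOpNormedRing
    let _ : NormedAlgebra ℂ (Op V) := Matrix.linftyOpNormedAlgebra
    exact hA.exp_right
  have h3 : (NormedSpace.exp N)ᴴ * NormedSpace.exp N = 1 := by
    rw [← Matrix.exp_conjTranspose, hN,
      ← Matrix.exp_add_of_commute _ _ (Commute.refl N).neg_left, neg_add_cancel,
      NormedSpace.exp_zero]
  rw [h1, Matrix.conjTranspose_mul]
  calc (NormedSpace.exp M)ᴴ * (NormedSpace.exp N)ᴴ * A * (NormedSpace.exp N * NormedSpace.exp M)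
      = (NormedSpace.exp M)ᴴ * ((NormedSpace.exp N)ᴴ * (A * NormedSpace.exp N)) *
          NormedSpace.exp M := by simp only [mul_assoc]
    _ = (NormedSpace.exp M)ᴴ * ((NormedSpace.exp N)ᴴ * NormedSpace.exp N * A) *
          NormedSpace.exp M := by rw [h2.eq]; simp only [mul_assoc]
    _ = _ := by rw [h3, one_mul]

theorem conjTranspose_smul_eq_neg {n : Type*} {H : Matrix n n ℂ} (hH : Hᴴ = H) (t : ℝ) :
    ((-Complex.I * (t : ℂ)) • H)ᴴ = -((-Complex.I * (t : ℂ)) • H) := by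
  rw [Matrix.conjTranspose_smul, hH, ← neg_smul]
  congr 1
  simp

/-- The part of the mixer acting on the qubits in `S`. -/
def mixerOn (S : Set V) : Op V := open Classical in ∑ v with v ∈ S, pauliX v

/-- Mixer terms outside `S` commute with `A` and cancel, so mixing does not enlarge the support. -/
theorem conj_exp_mixer {S : Set V} {A : Op V} (hA : ActsOn S A) (β : ℝ) :
    (NormedSpace.exp ((-Complex.I * (β : ℂ)) • mixer V))ᴴ * A *
        NormedSpace.exp ((-Complex.I * (β : ℂ)) • mixer V)
      = (NormedSpace.exp ((-Complex.I * (β : ℂ)) • mixerOn S))ᴴ * A *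
          NormedSpace.exp ((-Complex.I * (β : ℂ)) • mixerOn S) := by
  classical
  have h : mixer V = mixerOn S + ∑ v with v ∉ S, pauliX v := by
    rw [mixer, mixerOn, Finset.sum_filter_add_sum_filter_not]
  rw [h, smul_add, exp_add_conj]
  · refine Commute.smul_left (Commute.smul_right ?_ _) _
    exact Commute.sum_left _ _ _ fun u _ => Commute.sum_right _ _ _ fun v _ => commute_pauliX u v
  · refine conjTranspose_smul_eq_neg ?_ β
    rw [Matrix.conjTranspose_sum]
    exact Finset.sum_congr rfl fun v _ => conjTranspose_pauliX v
  · refine Commute.smul_right (Commute.sum_right _ _ _ fun v hv => ?_) _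
    exact (hA v (Finset.mem_filter.1 hv).2).1

theorem actsOn_mixerOn (S : Set V) : ActsOn S (mixerOn S) := by
  classical
  exact ActsOn.sum _ _ fun v hv => ActsOn.pauliX (Finset.mem_filter.1 hv).2

variable (G : SimpleGraph V) [DecidableRel G.Adj]

/-- The edge `e` has an endpoint in `S`. -/
def Meets (e : Sym2 V) (S : Set V) : Prop := ∃ v ∈ e, v ∈ S

/-- The part of the MaxCut Hamiltonian coming from the edges which meet `S`. -/
def hamiltonianOn (w : G.edgeSet → ℝ) (S : Set V) : Op V :=
  open Classical in
  (1 / 2 : ℂ) • ∑ e : G.edgeSet with Meets e.1 S, (w e : ℂ) • (1 - pauliZZ (e : Sym2 V))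

theorem commute_edgeTerm (a b : ℂ) (e e' : Sym2 V) :
    Commute (a • (1 - pauliZZ e) : Op V) (b • (1 - pauliZZ e')) := by
  refine Commute.smul_left (Commute.smul_right ?_ _) _
  exact (Commute.one_left _).sub_left ((Commute.one_right _).sub_right (commute_pauliZZ e e'))

theorem conj_exp_hamiltonian (w : G.edgeSet → ℝ) {S : Set V} {A : Op V} (hA : ActsOn S A) (γ : ℝ) :
    (NormedSpace.exp ((-Complex.I * (γ : ℂ)) • maxCutHamiltonian G w))ᴴ * A *
        NormedSpace.exp ((-Complex.I * (γ : ℂ)) • maxCutHamiltonian G w)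
      = (NormedSpace.exp ((-Complex.I * (γ : ℂ)) • hamiltonianOn G w S))ᴴ * A *
          NormedSpace.exp ((-Complex.I * (γ : ℂ)) • hamiltonianOn G w S) := by
  classical
  have h : maxCutHamiltonian G w = hamiltonianOn G w S +
      (1 / 2 : ℂ) • ∑ e : G.edgeSet with ¬ Meets e.1 S,
        (w e : ℂ) • (1 - pauliZZ (e : Sym2 V)) := by
    rw [maxCutHamiltonian, hamiltonianOn, ← smul_add, Finset.sum_filter_add_sum_filter_not]
  rw [h, smul_add, exp_add_conj]
  · refine Commute.smul_left (Commute.smul_right (Commute.smul_left (Commute.smul_right ?_ _) _) _) _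
    exact Commute.sum_left _ _ _ fun e _ => Commute.sum_right _ _ _ fun e' _ =>
      commute_edgeTerm _ _ _ _
  · refine conjTranspose_smul_eq_neg ?_ γ
    rw [Matrix.conjTranspose_smul, Matrix.conjTranspose_sum]
    congr 1
    · simp
    refine Finset.sum_congr rfl fun e _ => ?_
    rw [Matrix.conjTranspose_smul, Matrix.conjTranspose_sub, Matrix.conjTranspose_one,
      conjTranspose_pauliZZ]
    simp
  · refine Commute.smul_right (Commute.smul_right (Commute.sum_right _ _ _ fun e he => ?_) _) _
    refine Commute.smul_right ((Commute.one_right _).sub_right ?_) _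
    refine hA.commute_pauliZZ fun v hv hvS => (Finset.mem_filter.1 he).2 ⟨v, hv, hvS⟩

/-- The closed neighbourhood of a set of vertices. -/
def closedNbhd {V : Type u} (G : SimpleGraph V) (S : Set V) : Set V :=
  {v | v ∈ S ∨ ∃ u ∈ S, G.Adj u v}

/-- An edge meeting `S` has its other end in the neighbourhood: each cost layer enlarges the support
by one step. -/
theorem actsOn_hamiltonianOn (w : G.edgeSet → ℝ) (S : Set V) :
    ActsOn (closedNbhd G S) (hamiltonianOn G w S) := by
  classical
  refine (ActsOn.sum _ _ fun e he => ?_).smul _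
  refine (ActsOn.pauliZZ fun v hv => ?_).one_sub.smul _
  obtain ⟨u, hu, huS⟩ := (Finset.mem_filter.1 he).2
  by_cases huv : u = v
  · exact Or.inl (huv ▸ huS)
  · refine Or.inr ⟨u, huS, ?_⟩
    have := (Sym2.mem_and_mem_iff huv).1 ⟨hu, hv⟩
    exact (SimpleGraph.mem_edgeSet G).1 (this ▸ e.2)

theorem hamiltonianOn_congr {w w' : G.edgeSet → ℝ} {S : Set V}
    (h : ∀ e : G.edgeSet, Meets (e : Sym2 V) S → w e = w' e) :
    hamiltonianOn G w S = hamiltonianOn G w' S := by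
  classical
  unfold hamiltonianOn
  congr 1
  exact Finset.sum_congr rfl fun e he => by rw [h e (Finset.mem_filter.1 he).2]

theorem dotProduct_conj (U A : Op V) (ψ : Config V → ℂ) :
    star (U *ᵥ ψ) ⬝ᵥ (A *ᵥ (U *ᵥ ψ)) = star ψ ⬝ᵥ ((Uᴴ * A * U) *ᵥ ψ) := by
  rw [Matrix.star_mulVec, ← Matrix.dotProduct_mulVec, Matrix.mulVec_mulVec, Matrix.mulVec_mulVec,
    mul_assoc]

/-- The expectation of an observable on `S` in a state of depth `p` only depends on the weights
of the edges which meet the ball of radius `p - 1` around `S`. -/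
theorem expect_congr {p : ℕ} {w w' : G.edgeSet → ℝ} (γ β : Fin p → ℝ) {S : Set V} {A : Op V}
    (hA : ActsOn S A)
    (h : ∀ m < p, ∀ e : G.edgeSet, Meets (e : Sym2 V) ((closedNbhd G)^[m] S) → w e = w' e) :
    expect G w γ β A = expect G w' γ β A := by
  induction p generalizing S A with
  | zero => rfl
  | succ p ih =>
    have h1 : ActsOn S ((NormedSpace.exp ((-Complex.I * (β (Fin.last p) : ℂ)) • mixer V))ᴴ * A *
        NormedSpace.exp ((-Complex.I * (β (Fin.last p) : ℂ)) • mixer V)) := by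
      rw [conj_exp_mixer hA]
      have hB := ((actsOn_mixerOn S).smul (-Complex.I * (β (Fin.last p) : ℂ))).exp
      exact (hB.conjTranspose.mul hA).mul hB
    have hsub : S ⊆ closedNbhd G S := fun v hv => Or.inl hv
    have hC := ((actsOn_hamiltonianOn G w' S).smul (-Complex.I * (γ (Fin.last p) : ℂ))).exp
    have step : ∀ w : G.edgeSet → ℝ, expect G w γ β A = expect G w (Fin.init γ) (Fin.init β)
        ((NormedSpace.exp ((-Complex.I * (γ (Fin.last p) : ℂ)) • hamiltonianOn G w S))ᴴ *
          ((NormedSpace.exp ((-Complex.I * (β (Fin.last p) : ℂ)) • mixer V))ᴴ * A *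
            NormedSpace.exp ((-Complex.I * (β (Fin.last p) : ℂ)) • mixer V)) *
          NormedSpace.exp ((-Complex.I * (γ (Fin.last p) : ℂ)) • hamiltonianOn G w S)) := by
      intro w
      rw [← conj_exp_hamiltonian G w h1, expect, expect, state, dotProduct_conj, dotProduct_conj]
    have hw : hamiltonianOn G w S = hamiltonianOn G w' S := hamiltonianOn_congr G (h 0 p.succ_pos)
    rw [step, step, hw]
    -- The last layer has been absorbed into the observable, now supported on `closedNbhd G S`;
    -- radii therefore shift by one.
    refine ih _ _ ((hC.conjTranspose.mul (h1.mono hsub)).mul hC) fun m hm e he => ?_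
    refine h (m + 1) (by omega) e ?_
    rwa [Function.iterate_succ_apply]

end LightCone

/-! ### Levels, parents and the tree around an edge -/

section Levels

variable {V : Type u} (G : SimpleGraph V) (p : ℕ) (S : Set V)

/-- The distance of a vertex from `S`, cut off at `p + 1`. -/
def level (v : V) : ℕ := sInf {m | v ∈ (closedNbhd G)^[m] S ∨ m = p + 1}

variable {G p S}

theorem iterate_closedNbhd_mono {m n : ℕ} (h : m ≤ n) :
    (closedNbhd G)^[m] S ⊆ (closedNbhd G)^[n] S := by
  induction n, h using Nat.le_induction with
  | base => exact subset_rfl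
  | succ n _ ih =>
    rw [Function.iterate_succ_apply']
    exact fun v hv => Or.inl (ih hv)

theorem level_spec (v : V) :
    v ∈ (closedNbhd G)^[level G p S v] S ∨ level G p S v = p + 1 :=
  Nat.sInf_mem (s := {m | v ∈ (closedNbhd G)^[m] S ∨ m = p + 1}) ⟨p + 1, Or.inr rfl⟩

theorem level_le_iff {m : ℕ} (hm : m ≤ p) (v : V) :
    level G p S v ≤ m ↔ v ∈ (closedNbhd G)^[m] S := by
  constructor
  · intro h
    rcases level_spec (G := G) (p := p) (S := S) v with h' | h'
    · exact iterate_closedNbhd_mono h h'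
    · omega
  · intro h
    exact Nat.sInf_le (Or.inl h)

theorem level_le_succ (v : V) : level G p S v ≤ p + 1 := Nat.sInf_le (Or.inr rfl)

theorem level_eq_zero_iff (v : V) : level G p S v = 0 ↔ v ∈ S := by
  rw [← Nat.le_zero, level_le_iff (Nat.zero_le p)]
  rfl

theorem level_le_of_adj {u v : V} (h : G.Adj u v) : level G p S v ≤ level G p S u + 1 := by
  rcases Nat.lt_or_ge (level G p S u) p with hu | hu
  · rw [level_le_iff hu, Function.iterate_succ_apply']
    exact Or.inr ⟨u, (level_le_iff hu.le u).1 le_rfl, h⟩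
  · have := level_le_succ (G := G) (p := p) (S := S) v
    omega

theorem exists_parent {v : V} (h0 : 0 < level G p S v) (hp : level G p S v ≤ p) :
    ∃ u, G.Adj v u ∧ level G p S u + 1 = level G p S v := by
  obtain ⟨k, hk⟩ : ∃ k, level G p S v = k + 1 := ⟨level G p S v - 1, by omega⟩
  have hv := (level_le_iff (hk ▸ hp) v).1 hk.le
  rw [Function.iterate_succ_apply'] at hv
  rcases hv with hv | ⟨u, hu, huv⟩
  · have := (level_le_iff (by omega : k ≤ p) v).2 hv
    omega
  · have h1 := (level_le_iff (by omega : k ≤ p) u).2 hu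
    have h2 := level_le_of_adj (p := p) (S := S) huv
    exact ⟨u, huv.symm, by omega⟩

/-- Following parents lowers the level by one each time. The control on the support lets two such
walks be joined without passing through a given higher vertex. -/
theorem exists_walk_to_root (k : ℕ) (hk : k ≤ p) (x : V) (hx : level G p S x = k) :
    ∃ r ∈ S, ∃ q : G.Walk x r, q.length = k ∧ ∀ z ∈ q.support, z = x ∨ level G p S z < k := by
  induction k generalizing x with
  | zero =>
    exact ⟨x, (level_eq_zero_iff x).1 hx, SimpleGraph.Walk.nil, rfl, by simp⟩
  | succ k ih =>
    obtain ⟨u, hu, hul⟩ := exists_parent (hx ▸ k.succ_pos) (hx ▸ hk)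
    obtain ⟨r, hr, q, hq, hs⟩ := ih (by omega) u (by omega)
    refine ⟨r, hr, SimpleGraph.Walk.cons hu q, by simp [hq], fun z hz => ?_⟩
    rw [SimpleGraph.Walk.support_cons, List.mem_cons] at hz
    rcases hz with rfl | hz
    · exact Or.inl rfl
    · rcases hs z hz with rfl | h
      · exact Or.inr (by omega)
      · exact Or.inr (by omega)

/-- An edge together with a walk joining its ends without using it gives a cycle. -/
theorem egirth_le_of_walk {v x : V} (h : G.Adj v x) (q : G.Walk v x) (hq : s(v, x) ∉ q.edges) :
    G.egirth ≤ (q.length + 1 : ℕ) := by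
  classical
  have hc := SimpleGraph.Path.cons_isCycle q.toPath h.symm fun h' => hq <| by
    rw [Sym2.eq_swap] at h'
    exact q.edges_bypass_subset_edges h'
  refine (SimpleGraph.egirth_le_length hc).trans ?_
  have := q.length_bypass_le_length
  rw [SimpleGraph.Walk.length_cons]
  exact_mod_cast Nat.succ_le_succ this

variable (hS : ∀ a ∈ S, ∀ b ∈ S, a = b ∨ G.Adj a b)
  (hg : ((2 * p + 1 : ℕ) : ℕ∞) < G.egirth)
include hS hg

/-- Within the girth, a vertex has at most one neighbour which is not further
from `S`. -/
theorem eq_of_adj_of_level_le {v x y : V}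
    (hx : G.Adj v x) (hy : G.Adj v y) (hxv : level G p S x ≤ level G p S v)
    (hyv : level G p S y ≤ level G p S v) (hxp : level G p S x < p) (hyp : level G p S y < p) :
    x = y := by
  by_contra hxy
  obtain ⟨r, hr, q, hq, hqs⟩ := exists_walk_to_root _ hxp.le x rfl
  obtain ⟨r', hr', q', hq', hqs'⟩ := exists_walk_to_root _ hyp.le y rfl
  have hvq : v ∉ q.support := fun hv => by
    rcases hqs v hv with h | h
    · exact hx.ne h
    · omega
  have hvq' : v ∉ q'.support := fun hv => by
    rcases hqs' v hv with h | h
    · exact hy.ne h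
    · omega
  -- The two descents have length at most `p - 1` and at most one edge joins their roots. Closing up
  -- through `v` adds two edges, giving a cycle of length at most `2p + 1`.
  obtain ⟨W, hW, hvW⟩ : ∃ W : G.Walk y x, W.length + 1 ≤ 2 * p ∧ v ∉ W.support := by
    rcases hS r' hr' r hr with h | h
    · subst h
      refine ⟨q'.append q.reverse, ?_, ?_⟩
      · simp only [SimpleGraph.Walk.length_append, SimpleGraph.Walk.length_reverse]
        omega
      · rw [SimpleGraph.Walk.mem_support_append_iff]
        simp [hvq, hvq']
    · refine ⟨q'.append (SimpleGraph.Walk.cons h q.reverse), ?_, ?_⟩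
      · simp only [SimpleGraph.Walk.length_append, SimpleGraph.Walk.length_reverse,
          SimpleGraph.Walk.length_cons]
        omega
      · rw [SimpleGraph.Walk.mem_support_append_iff]
        have : v ≠ r' := fun h => hvq' (h ▸ q'.end_mem_support)
        simp [hvq, hvq', this]
  have hcyc := egirth_le_of_walk hx (SimpleGraph.Walk.cons hy W) <| by
    rw [SimpleGraph.Walk.edges_cons, List.mem_cons]
    rintro (h | h)
    · exact hxy (Sym2.congr_right.1 h)
    · exact hvW (SimpleGraph.Walk.fst_mem_support_of_mem_edges _ h)
  rw [SimpleGraph.Walk.length_cons] at hcyc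
  have := hg.trans_le hcyc
  have : 2 * p + 1 < W.length + 1 + 1 := by exact_mod_cast this
  omega

end Levels

/-- The tree of radius `p` around the edge `e` of a regular graph of large girth, given by levels
and parents. -/
theorem exists_levels_parents {V : Type u} [Fintype V] [DecidableEq V] (G : SimpleGraph V)
    [DecidableRel G.Adj] {p D : ℕ} (hreg : G.IsRegularOfDegree (D + 1))
    (hg : ((2 * p + 1 : ℕ) : ℕ∞) < G.egirth) (e : G.edgeSet) :
    ∃ (l : V → ℕ) (par : V → V), (∀ v, l v = 0 ↔ v ∈ (e : Sym2 V)) ∧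
      (∀ v, 0 < l v → l v ≤ p → l (par v) + 1 = l v) ∧
      (∀ u, l u < p → #{v | (0 < l v ∧ l v ≤ p) ∧ par v = u} = D) ∧
      (∀ m < p, ∀ v ∈ (closedNbhd G)^[m] {v | v ∈ (e : Sym2 V)}, l v < p) ∧
      ∀ F : Sym2 V → ℂ,
        (∏ e' : G.edgeSet, if e' ≠ e ∧ ∃ v ∈ e'.1, l v < p then F e' else 1) =
          ∏ v with 0 < l v ∧ l v ≤ p, F s(v, par v) := by
  classical
  set S : Set V := {v | v ∈ (e : Sym2 V)} with hSdef
  set l := level G p S with hl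
  have hS : ∀ a ∈ S, ∀ b ∈ S, a = b ∨ G.Adj a b := by
    intro a ha b hb
    by_cases hab : a = b
    · exact Or.inl hab
    · right
      have := (Sym2.mem_and_mem_iff hab).1 ⟨ha, hb⟩
      exact (SimpleGraph.mem_edgeSet G).1 (this ▸ e.2)
  have hl0 : ∀ v, l v = 0 ↔ v ∈ (e : Sym2 V) := fun v => level_eq_zero_iff v
  -- Outside levels `1, …, p` the parent is a junk value, `v` itself.
  have hpar : ∀ v, ∃ u, 0 < l v → l v ≤ p → G.Adj v u ∧ l u + 1 = l v := by
    intro v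
    by_cases h : 0 < l v ∧ l v ≤ p
    · obtain ⟨u, hu⟩ := exists_parent h.1 h.2
      exact ⟨u, fun _ _ => hu⟩
    · exact ⟨v, fun h1 h2 => absurd ⟨h1, h2⟩ h⟩
  choose par hpar using hpar
  have huniq : ∀ {v x : V}, 0 < l v → l v ≤ p → G.Adj v x → l x ≤ l v → l x < p → x = par v := by
    intro v x h0 hp hx hxv hxp
    obtain ⟨h1, h2⟩ := hpar v h0 hp
    exact eq_of_adj_of_level_le hS hg hx h1 hxv
      (Nat.le_of_lt (Nat.lt_of_succ_le h2.le)) hxp (Nat.lt_of_succ_le (h2.le.trans hp))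
  have hup : ∀ {u v : V}, G.Adj u v → l v ≤ l u + 1 := fun h => level_le_of_adj h
  have hroot : ∀ {u v : V}, G.Adj u v → l u = 0 → l v = 0 → s(u, v) = e := by
    intro u v h hu hv
    exact ((Sym2.mem_and_mem_iff h.ne).1 ⟨(hl0 u).1 hu, (hl0 v).1 hv⟩).symm
  refine ⟨l, par, hl0, fun v h1 h2 => (hpar v h1 h2).2, fun u hu => ?_, fun m hm v hv => ?_,
    fun F => ?_⟩
  -- Exactly one neighbour `o` of `u` is not a child: the other end of `e` if `u` is a root, the
  -- parent of `u` otherwise. This leaves `D` of the `D + 1` neighbours.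
  · obtain ⟨o, ho, hoC, hcov⟩ : ∃ o, G.Adj u o ∧ ¬ ((0 < l o ∧ l o ≤ p) ∧ par o = u) ∧
        ∀ v, G.Adj u v → v ≠ o → (0 < l v ∧ l v ≤ p) ∧ par v = u := by
      rcases Nat.eq_zero_or_pos (l u) with h0 | h0
      · obtain ⟨o, ho⟩ := (hl0 u).1 h0
        have hadj : G.Adj u o := (SimpleGraph.mem_edgeSet G).1 (ho ▸ e.2)
        have ho0 : l o = 0 := (hl0 o).2 (ho ▸ Sym2.mem_mk_right u o)
        refine ⟨o, hadj, fun h => by omega, fun v huv hvo => ?_⟩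
        have h1 : l v ≠ 0 := fun hv => by
          have := (hroot huv h0 hv).trans ho
          exact hvo (Sym2.congr_right.1 this)
        have h2 := hup huv
        exact ⟨⟨by omega, by omega⟩, (huniq (by omega) (by omega) huv.symm (by omega) hu).symm⟩
      · obtain ⟨h1, h2⟩ := hpar u h0 hu.le
        refine ⟨par u, h1, fun h => ?_, fun v huv hvo => ?_⟩
        · have := (hpar _ h.1.1 h.1.2).2
          rw [h.2] at this
          omega
        · have h3 : l u < l v := by
            by_contra h
            exact hvo (huniq h0 hu.le huv (by omega) (by omega))
          have h4 := hup huv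
          exact ⟨⟨by omega, by omega⟩, (huniq (by omega) (by omega) huv.symm (by omega) hu).symm⟩
    have hn : G.neighborFinset u = insert o ({v | (0 < l v ∧ l v ≤ p) ∧ par v = u} : Finset V) := by
      ext v
      simp only [SimpleGraph.mem_neighborFinset, Finset.mem_insert, Finset.mem_filter,
        Finset.mem_univ, true_and]
      constructor
      · intro huv
        by_cases hvo : v = o
        · exact Or.inl hvo
        · exact Or.inr (hcov v huv hvo)
      · rintro (rfl | h)
        · exact ho
        · have := (hpar v h.1.1 h.1.2).1
          rw [h.2] at this
          exact this.symm
    have hcard := congrArg Finset.card hn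
    rw [SimpleGraph.card_neighborFinset_eq_degree, hreg u, Finset.card_insert_of_notMem] at hcard
    · omega
    · simpa using hoC
  · exact ((level_le_iff hm.le v).2 hv).trans_lt hm
  -- The tree edges other than `e` correspond to the vertices of levels `1, …, p`, each edge to its
  -- deeper end.
  · rw [← Finset.prod_filter]
    symm
    refine Finset.prod_bij (fun v hv => ⟨s(v, par v), ?_⟩) ?_ ?_ ?_ ?_
    · have h := (Finset.mem_filter.1 hv).2
      exact (hpar v h.1 h.2).1
    · intro v hv
      have h := (Finset.mem_filter.1 hv).2
      have h' := hpar v h.1 h.2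
      refine Finset.mem_filter.2 ⟨Finset.mem_univ _, fun he => ?_, par v, by simp, by omega⟩
      have : v ∈ (e : Sym2 V) := by rw [← he]; simp
      have := (hl0 v).2 this
      omega
    · intro v hv v' hv' heq
      have h := (Finset.mem_filter.1 hv).2
      have h' := (Finset.mem_filter.1 hv').2
      rcases Sym2.eq_iff.1 (congrArg Subtype.val heq) with h1 | h1
      · exact h1.1
      · have h2 := (hpar v h.1 h.2).2
        have h3 := (hpar v' h'.1 h'.2).2
        rw [← h1.1] at h3
        rw [h1.2] at h2
        omega
    · rintro ⟨e', he'⟩ hmem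
      obtain ⟨hne, a, ha, hap⟩ := (Finset.mem_filter.1 hmem).2
      obtain ⟨b, rfl⟩ := ha
      have hab : G.Adj a b := he'
      rcases Nat.lt_or_ge (l a) (l b) with h | h
      · have h1 := hup hab
        have h2 : a = par b := huniq (by omega) (by omega) hab.symm h.le hap
        refine ⟨b, by simp; omega, ?_⟩
        exact Subtype.ext (by simp only [← h2]; exact Sym2.eq_swap)
      · rcases Nat.eq_zero_or_pos (l a) with h0 | h0
        · exact absurd (Subtype.ext (hroot hab h0 (by omega))) hne
        · have h2 : b = par a := huniq h0 hap.le hab h (by omega)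
          exact ⟨a, by simp; omega, Subtype.ext (by simp only [← h2])⟩
    · intro v hv
      rfl

/-! ### Summation over a tree from the leaves inwards -/

section Peeling

/-- The total weight of the `D` branches of depth `m` below a vertex with value `a`. -/
def branch {A : Type*} [Fintype A] (f : A → ℂ) (k : A → A → ℂ) (D : ℕ) : ℕ → A → ℂ
  | 0, _ => 1
  | m + 1, a => (∑ b, f b * (branch f k D m b * k b a)) ^ D


variable {V : Type u} [Fintype V] [DecidableEq V] {A : Type*} [Fintype A] {f : A → ℂ}
  (hf : ∑ a, f a = 1)
include hf

theorem sum_prod_weight : ∑ σ : V → A, ∏ v, f (σ v) = 1 := by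
  classical
  rw [← Fintype.piFinset_univ, ← Finset.prod_univ_sum]
  simp [hf]

/-- Resampling the value at one vertex. -/
theorem sum_prod_weight_mul (v : V) (Θ : (V → A) → ℂ) :
    ∑ σ : V → A, (∏ u, f (σ u)) * Θ σ =
      ∑ σ : V → A, (∏ u, f (σ u)) * ∑ b, f b * Θ (Function.update σ v b) := by
  -- Exchanging the value at `v` with an independent sample is an involution preserving the joint
  -- weight.
  let e : (V → A) × A → (V → A) × A := fun x => (Function.update x.1 v x.2, x.1 v)
  have he : Function.Involutive e := fun x => by simp [e]
  have hw : ∀ (σ : V → A) (b : A),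
      (∏ u, f (Function.update σ v b u)) * f (σ v) = (∏ u, f (σ u)) * f b := by
    intro σ b
    rw [← Finset.mul_prod_erase _ _ (Finset.mem_univ v),
      ← Finset.mul_prod_erase _ (fun u => f (σ u)) (Finset.mem_univ v)]
    have : ∏ u ∈ Finset.univ.erase v, f (Function.update σ v b u) =
        ∏ u ∈ Finset.univ.erase v, f (σ u) :=
      Finset.prod_congr rfl fun u hu => by rw [Function.update_of_ne (Finset.ne_of_mem_erase hu)]
    rw [this, Function.update_self]
    ring
  calc ∑ σ : V → A, (∏ u, f (σ u)) * Θ σ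
      = ∑ x : (V → A) × A, (∏ u, f (x.1 u)) * f x.2 * Θ x.1 := by
        rw [Fintype.sum_prod_type]
        refine Finset.sum_congr rfl fun σ _ => ?_
        simp only
        rw [← Finset.sum_mul, ← Finset.mul_sum, hf, mul_one]
    _ = ∑ x : (V → A) × A, (∏ u, f (x.1 u)) * f x.2 * Θ (Function.update x.1 v x.2) := by
        rw [← Equiv.sum_comp he.toPerm]
        refine Finset.sum_congr rfl fun x _ => ?_
        simp only [Function.Involutive.coe_toPerm, e, hw]
    _ = _ := by
        rw [Fintype.sum_prod_type]
        refine Finset.sum_congr rfl fun σ _ => ?_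
        rw [Finset.mul_sum]
        exact Finset.sum_congr rfl fun b _ => by ring

/-- Summing out an independent set `W` of vertices. -/
theorem sum_prod_weight_independent (W : Finset V) (φ : V → A → (V → A) → ℂ) (Ω : (V → A) → ℂ)
    (hφ : ∀ u ∈ W, ∀ v ∈ W, ∀ a σ b, φ v a (Function.update σ u b) = φ v a σ)
    (hΩ : ∀ u ∈ W, ∀ σ b, Ω (Function.update σ u b) = Ω σ) :
    ∑ σ : V → A, (∏ u, f (σ u)) * ((∏ v ∈ W, φ v (σ v) σ) * Ω σ) =
      ∑ σ : V → A, (∏ u, f (σ u)) * ((∏ v ∈ W, ∑ b, f b * φ v b σ) * Ω σ) := by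
  induction W using Finset.induction_on generalizing Ω with
  | empty => simp
  | insert v W hv ih =>
    have h1 : ∀ σ : V → A, ∑ b, f b * ((∏ u ∈ insert v W,
        φ u (Function.update σ v b u) (Function.update σ v b)) * Ω (Function.update σ v b)) =
        (∏ u ∈ W, φ u (σ u) σ) * ((∑ b, f b * φ v b σ) * Ω σ) := by
      intro σ
      rw [Finset.sum_mul, Finset.mul_sum]
      refine Finset.sum_congr rfl fun b _ => ?_
      rw [Finset.prod_insert hv, Function.update_self, hΩ v (Finset.mem_insert_self _ _),
        hφ v (Finset.mem_insert_self _ _) v (Finset.mem_insert_self _ _)]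
      have : ∏ u ∈ W, φ u (Function.update σ v b u) (Function.update σ v b) =
          ∏ u ∈ W, φ u (σ u) σ := by
        refine Finset.prod_congr rfl fun u hu => ?_
        rw [hφ v (Finset.mem_insert_self _ _) u (Finset.mem_insert_of_mem hu),
          Function.update_of_ne (ne_of_mem_of_not_mem hu hv)]
      rw [this]
      ring
    rw [sum_prod_weight_mul hf v]
    simp only [h1]
    rw [ih]
    · refine Finset.sum_congr rfl fun σ _ => ?_
      rw [Finset.prod_insert hv]
      ring
    · exact fun u hu v' hv' => hφ u (Finset.mem_insert_of_mem hu) v' (Finset.mem_insert_of_mem hv')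
    · intro u hu σ b
      rw [hΩ u (Finset.mem_insert_of_mem hu)]
      congr 1
      refine Finset.sum_congr rfl fun b' _ => ?_
      rw [hφ u (Finset.mem_insert_of_mem hu) v (Finset.mem_insert_self _ _)]

theorem sum_prod_weight_pair {L R : V} (hLR : L ≠ R) (Θ : A → A → ℂ) :
    ∑ σ : V → A, (∏ u, f (σ u)) * Θ (σ L) (σ R) = ∑ a, ∑ b, f a * (f b * Θ a b) := by
  rw [sum_prod_weight_mul hf L, sum_prod_weight_mul hf R]
  simp only [Function.update_self, Function.update_of_ne hLR.symm]
  have h : ∑ b, f b * ∑ a, f a * Θ a b = ∑ a, ∑ b, f a * (f b * Θ a b) := by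
    rw [Finset.sum_comm]
    refine Finset.sum_congr rfl fun b _ => ?_
    rw [Finset.mul_sum]
    exact Finset.sum_congr rfl fun a _ => by ring
  rw [← Finset.sum_mul, sum_prod_weight hf, one_mul, h]

/-- After `m` steps the outermost `m` levels are summed out. The vertices of one level are not each
other's parents, so they are summed independently. -/
theorem sum_prod_weight_levels (k : A → A → ℂ) {p D : ℕ} {l : V → ℕ} {par : V → V}
    (hpar : ∀ v, 0 < l v → l v ≤ p → l (par v) + 1 = l v)
    (hD : ∀ u, l u < p → #{v | (0 < l v ∧ l v ≤ p) ∧ par v = u} = D)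
    (Ω : (V → A) → ℂ) (hΩ : ∀ u, 0 < l u → ∀ σ b, Ω (Function.update σ u b) = Ω σ)
    (m : ℕ) (hm : m ≤ p) :
    ∑ σ : V → A, (∏ u, f (σ u)) *
        ((∏ v with 0 < l v ∧ l v ≤ p, k (σ v) (σ (par v))) * Ω σ) =
      ∑ σ : V → A, (∏ u, f (σ u)) * ((∏ v with l v = p - m, branch f k D m (σ v)) *
        ((∏ v with 0 < l v ∧ l v ≤ p - m, k (σ v) (σ (par v))) * Ω σ)) := by
  induction m with
  | zero => simp [branch]
  | succ m ih =>
    rw [ih (by omega)]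
    obtain ⟨q, hq⟩ : ∃ q, p - m = q + 1 := ⟨p - m - 1, by omega⟩
    have hq' : p - (m + 1) = q := by omega
    rw [hq, hq']
    have hsplit : ∀ σ : V → A, (∏ v with 0 < l v ∧ l v ≤ q + 1, k (σ v) (σ (par v))) =
        (∏ v with l v = q + 1, k (σ v) (σ (par v))) *
          ∏ v with 0 < l v ∧ l v ≤ q, k (σ v) (σ (par v)) := by
      intro σ
      rw [← Finset.prod_union]
      · refine Finset.prod_congr ?_ fun _ _ => rfl
        ext v
        simp only [Finset.mem_filter, Finset.mem_univ, true_and, Finset.mem_union]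
        omega
      · rw [Finset.disjoint_filter]
        intro v _ h
        omega
    have h1 : ∀ σ : V → A, (∏ v with l v = q + 1, branch f k D m (σ v)) *
        ((∏ v with 0 < l v ∧ l v ≤ q + 1, k (σ v) (σ (par v))) * Ω σ) =
        (∏ v with l v = q + 1, branch f k D m (σ v) * k (σ v) (σ (par v))) *
          ((∏ v with 0 < l v ∧ l v ≤ q, k (σ v) (σ (par v))) * Ω σ) := by
      intro σ
      rw [hsplit, Finset.prod_mul_distrib]
      ring
    simp only [h1]
    rw [sum_prod_weight_independent hf _ (fun v b σ => branch f k D m b * k b (σ (par v)))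
      (fun σ => (∏ v with 0 < l v ∧ l v ≤ q, k (σ v) (σ (par v))) * Ω σ)]
    · refine Finset.sum_congr rfl fun σ _ => ?_
      congr 2
      -- Grouping by parent: the `D` children of `u` contribute equal factors, which produces the
      -- `D`-th power in `branch`.
      rw [← Finset.prod_fiberwise_of_maps_to (t := ({u | l u = q} : Finset V)) (g := par)]
      · refine Finset.prod_congr rfl fun u hu => ?_
        have hu' := (Finset.mem_filter.1 hu).2
        rw [Finset.prod_congr rfl (g := fun _ => ∑ b, f b * (branch f k D m b * k b (σ u))),
          Finset.prod_const, Finset.filter_filter, branch, ← hD u (by omega)]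
        · congr 2
          ext v
          simp only [Finset.mem_filter, Finset.mem_univ, true_and]
          constructor
          · rintro ⟨h, h'⟩
            exact ⟨by omega, h'⟩
          · rintro ⟨h, h'⟩
            have := hpar v h.1 h.2
            rw [h'] at this
            exact ⟨by omega, h'⟩
        · intro v hv
          rw [(Finset.mem_filter.1 hv).2]
      · intro v hv
        have hv' := (Finset.mem_filter.1 hv).2
        have := hpar v (by omega) (by omega)
        exact Finset.mem_filter.2 ⟨Finset.mem_univ _, by omega⟩
    · intro u hu v hv a σ b
      have hu' := (Finset.mem_filter.1 hu).2
      have hv' := (Finset.mem_filter.1 hv).2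
      have := hpar v (by omega) (by omega)
      have hne : par v ≠ u := fun h => by rw [h] at this; omega
      simp only [Function.update_of_ne hne]
    · intro u hu σ b
      have hu' := (Finset.mem_filter.1 hu).2
      rw [hΩ u (by omega)]
      congr 1
      refine Finset.prod_congr rfl fun v hv => ?_
      have hv' := (Finset.mem_filter.1 hv).2
      have := hpar v (by omega) (by omega)
      have hne : par v ≠ u := fun h => by rw [h] at this; omega
      have hne' : v ≠ u := fun h => by rw [h] at hv'; omega
      rw [Function.update_of_ne hne, Function.update_of_ne hne']

/-- The tree recursion for a sum over all assignments of values to the vertices. -/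
theorem sum_prod_weight_tree (k : A → A → ℂ) {p D : ℕ} {l : V → ℕ} {par : V → V}
    (hpar : ∀ v, 0 < l v → l v ≤ p → l (par v) + 1 = l v)
    (hD : ∀ u, l u < p → #{v | (0 < l v ∧ l v ≤ p) ∧ par v = u} = D)
    {L R : V} (hLR : L ≠ R) (h0 : ∀ v, l v = 0 ↔ v ∈ s(L, R)) (Θ : A → A → ℂ) :
    ∑ σ : V → A, (∏ u, f (σ u)) *
        ((∏ v with 0 < l v ∧ l v ≤ p, k (σ v) (σ (par v))) * Θ (σ L) (σ R)) =
      ∑ a, ∑ b, f a * (f b * (branch f k D p a * branch f k D p b * Θ a b)) := by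
  have hL : l L = 0 := (h0 L).2 (by simp)
  have hR : l R = 0 := (h0 R).2 (by simp)
  rw [sum_prod_weight_levels hf k hpar hD (fun σ => Θ (σ L) (σ R)) _ p le_rfl,
    ← sum_prod_weight_pair hf hLR]
  · refine Finset.sum_congr rfl fun σ _ => ?_
    have h1 : ({v | l v = p - p} : Finset V) = {L, R} := by
      ext v
      simp [h0]
    have h2 : ({v | 0 < l v ∧ l v ≤ p - p} : Finset V) = ∅ := by
      refine Finset.filter_eq_empty_iff.2 fun v _ h => by omega
    rw [h1, h2, Finset.prod_pair hLR, Finset.prod_empty, one_mul]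
  · intro u hu σ b
    have h1 : L ≠ u := fun h => by rw [← h] at hu; omega
    have h2 : R ≠ u := fun h => by rw [← h] at hu; omega
    simp only [Function.update_of_ne h1, Function.update_of_ne h2]

end Peeling

/-! ### Averaging over the random weights -/

section Average

/-- The average of `e^{iwt/2}` over the weight `w`. -/
def phaseAverage (law : Measure ℝ) (t : ℝ) : ℂ :=
  ∫ x, Complex.exp (Complex.I * (x / 2 * t : ℝ)) ∂law

/-- The average of `w e^{iwt/2}` over the weight `w`. -/
def weightedPhaseAverage (law : Measure ℝ) (t : ℝ) : ℂ :=
  ∫ x, (x : ℂ) * Complex.exp (Complex.I * (x / 2 * t : ℝ)) ∂law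

theorem norm_exp_I_mul_ofReal (x : ℝ) : ‖Complex.exp (Complex.I * (x : ℂ))‖ = 1 := by
  rw [mul_comm, Complex.norm_exp_ofReal_mul_I]

variable {law : Measure ℝ}

theorem integrable_phase [IsFiniteMeasure law] (t : ℝ) :
    Integrable (fun x : ℝ => Complex.exp (Complex.I * (x / 2 * t : ℝ))) law := by
  refine (integrable_const (1 : ℝ)).mono' ?_ (ae_of_all _ fun x => ?_)
  · exact (by fun_prop : Continuous fun x : ℝ =>
      Complex.exp (Complex.I * (x / 2 * t : ℝ))).aestronglyMeasurable
  · exact (norm_exp_I_mul_ofReal _).le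

theorem integrable_weightedPhase (hlaw : Integrable (fun x : ℝ => x) law) (t : ℝ) :
    Integrable (fun x : ℝ => (x : ℂ) * Complex.exp (Complex.I * (x / 2 * t : ℝ))) law := by
  refine hlaw.norm.mono' ?_ (ae_of_all _ fun x => ?_)
  · exact (by fun_prop : Continuous fun x : ℝ =>
      (x : ℂ) * Complex.exp (Complex.I * (x / 2 * t : ℝ))).aestronglyMeasurable
  · rw [norm_mul, norm_exp_I_mul_ofReal, mul_one, Complex.norm_real]

/-- The correlation across the central edge of the `(D+1)`-regular tree of radius `p`, multiplied
by the weight of that edge and averaged over the weights. -/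
def treeCorrelation (law : Measure ℝ) {p : ℕ} (D : ℕ) (γ β : Fin p → ℝ) : ℂ :=
  ∑ a, ∑ b, siteWeight β a * (siteWeight β b *
    (branch (siteWeight β) (fun b a => phaseAverage law (sitePhase γ b a)) D p a *
      branch (siteWeight β) (fun b a => phaseAverage law (sitePhase γ b a)) D p b *
      (weightedPhaseAverage law (sitePhase γ a b) * ((a.2.2 * b.2.2 : ℤˣ) : ℤ))))

variable {V : Type u} [Fintype V] [DecidableEq V] (G : SimpleGraph V) [DecidableRel G.Adj]

/-- `P` stands for the light cone: edges outside it have weight zero, hence phase factor 1. For a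
fixed history the integrand is a product over edges, and independence integrates each factor
separately. -/
theorem integral_weight_mul_pathSum [IsProbabilityMeasure law]
    (hlaw : Integrable (fun x : ℝ => x) law) {p : ℕ}
    (γ β : Fin p → ℝ) (e : G.edgeSet) (P : G.edgeSet → Prop) [DecidablePred P] :
    Integrable (fun w : G.edgeSet → ℝ => (w e : ℂ) *
      pathSum G (fun e' => if e' = e ∨ P e' then w e' else 0) γ β e) (weightLaw G law) ∧
    ∫ w, (w e : ℂ) * pathSum G (fun e' => if e' = e ∨ P e' then w e' else 0) γ β e
        ∂(weightLaw G law) =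
      ∑ σ : V → Site p, (∏ v, siteWeight β (σ v)) *
        ((∏ e', if e' ≠ e ∧ P e' then phaseAverage law (edgePhase γ σ e') else 1) *
          (weightedPhaseAverage law (edgePhase γ σ e) *
            ((pairSpin (fun v => (σ v).2.2) e : ℤ) : ℂ))) := by
  let F : (V → Site p) → G.edgeSet → ℝ → ℂ := fun σ e' x =>
    if e' = e then (x : ℂ) * Complex.exp (Complex.I * (x / 2 * edgePhase γ σ e' : ℝ))
    else if P e' then Complex.exp (Complex.I * (x / 2 * edgePhase γ σ e' : ℝ)) else 1
  have hF : ∀ σ e', Integrable (F σ e') law := by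
    intro σ e'
    simp only [F]
    split_ifs
    · exact integrable_weightedPhase hlaw _
    · exact integrable_phase _
    · exact integrable_const _
  have hsplit : ∀ (X : ℂ) (Y : G.edgeSet → ℂ),
      (∏ e', if e' = e then X else if P e' then Y e' else 1) =
        X * ∏ e', if e' ≠ e ∧ P e' then Y e' else 1 := by
    intro X Y
    have : X = ∏ e' : G.edgeSet, if e' = e then X else 1 := by simp
    conv_rhs => rw [this]
    rw [← Finset.prod_mul_distrib]
    refine Finset.prod_congr rfl fun e' _ => ?_
    by_cases h : e' = e <;> simp [h]
  have hprod : ∀ w : G.edgeSet → ℝ, (w e : ℂ) *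
      pathSum G (fun e' => if e' = e ∨ P e' then w e' else 0) γ β e =
      ∑ σ : V → Site p, ((∏ v, siteWeight β (σ v)) *
        ((pairSpin (fun v => (σ v).2.2) e : ℤ) : ℂ)) * ∏ e', F σ e' (w e') := by
    intro w
    rw [pathSum, Finset.mul_sum]
    refine Finset.sum_congr rfl fun σ _ => ?_
    have h1 : ∏ e', F σ e' (w e') = (w e : ℂ) * ∏ e' : G.edgeSet, Complex.exp (Complex.I *
        ((if e' = e ∨ P e' then w e' else 0) / 2 * edgePhase γ σ e' : ℝ)) := by
      have : (w e : ℂ) = ∏ e' : G.edgeSet, if e' = e then (w e : ℂ) else 1 := by simp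
      rw [this, ← Finset.prod_mul_distrib]
      refine Finset.prod_congr rfl fun e' _ => ?_
      by_cases h : e' = e
      · subst h
        simp [F]
      · by_cases h' : P e' <;> simp [F, h, h']
    rw [h1]
    ring
  have hint : ∀ σ, Integrable (fun w : G.edgeSet → ℝ => ∏ e', F σ e' (w e')) (weightLaw G law) :=
    fun σ => Integrable.fintype_prod (f := F σ) (hF σ)
  simp only [hprod]
  refine ⟨integrable_finsetSum _ fun σ _ => (hint σ).const_mul _, ?_⟩
  rw [integral_finsetSum _ fun σ _ => (hint σ).const_mul _]
  refine Finset.sum_congr rfl fun σ _ => ?_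
  rw [integral_const_mul, weightLaw, integral_fintype_prod_eq_prod]
  have h2 : ∀ e', ∫ x, F σ e' x ∂law = if e' = e then weightedPhaseAverage law (edgePhase γ σ e)
      else if P e' then phaseAverage law (edgePhase γ σ e') else 1 := by
    intro e'
    simp only [F]
    split_ifs with h1 h2
    · subst h1; rfl
    · rfl
    · simp
  rw [Finset.prod_congr rfl fun e' _ => h2 e', hsplit]
  ring

/-- Weights are cut down to the light cone before the path sum is expanded, so that only tree edges
carry phases. The result no longer refers to `G` or `e`. -/
theorem weight_mul_expect [IsProbabilityMeasure law] (hlaw : Integrable (fun x : ℝ => x) law)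
    {p D : ℕ} (hreg : G.IsRegularOfDegree (D + 1)) (hg : ((2 * p + 1 : ℕ) : ℕ∞) < G.egirth)
    (γ β : Fin p → ℝ) (e : G.edgeSet) :
    Integrable (fun w => w e * expect G w γ β (pauliZZ (e : Sym2 V))) (weightLaw G law) ∧
      edgeCorrelation G law γ β e = (treeCorrelation law D γ β).re := by
  classical
  obtain ⟨l, par, h0, hpar, hD, hball, hprod⟩ := exists_levels_parents G hreg hg e
  obtain ⟨hI, hS⟩ := integral_weight_mul_pathSum G hlaw γ β e (fun e' => ∃ v ∈ e'.1, l v < p)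
  have hre : ∀ w : G.edgeSet → ℝ, w e * expect G w γ β (pauliZZ (e : Sym2 V)) =
      RCLike.re ((w e : ℂ) * pathSum G
        (fun e' => if e' = e ∨ ∃ v ∈ e'.1, l v < p then w e' else 0) γ β e) := by
    intro w
    rw [← expect_congr (w := fun e' => if e' = e ∨ ∃ v ∈ e'.1, l v < p then w e' else 0)
      (w' := w) G γ β (S := {v | v ∈ (e : Sym2 V)}) (ActsOn.pauliZZ fun v hv => hv),
      expect_pauliZZ_eq]
    · simp
    · intro m hm e' ⟨v, hv, hvm⟩
      exact if_pos (Or.inr ⟨v, hv, hball m hm v hvm⟩)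
  refine ⟨by simpa only [hre] using hI.re, ?_⟩
  rw [edgeCorrelation]
  simp only [hre]
  rw [integral_re hI, hS, treeCorrelation]
  refine congrArg Complex.re ?_
  refine (Finset.sum_congr rfl fun σ _ => congrArg (_ * ·) (congrArg (· * _)
    (hprod fun s => phaseAverage law (edgePhase γ σ s)))).trans ?_
  obtain ⟨e, he⟩ := e
  induction e with
  | h L R =>
    have hLR : L ≠ R := ((SimpleGraph.mem_edgeSet G).1 he).ne
    exact sum_prod_weight_tree (sum_siteWeight β)
      (fun b a => phaseAverage law (sitePhase γ b a)) hpar hD hLR h0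
      (fun a b => weightedPhaseAverage law (sitePhase γ a b) * ((a.2.2 * b.2.2 : ℤˣ) : ℤ))

end Average

/-! ### From the edge correlation to the energy -/

section Energy

variable {V : Type u} [Fintype V] [DecidableEq V] (G : SimpleGraph V) [DecidableRel G.Adj]

theorem conjTranspose_exp_mul_exp {H : Op V} (hH : Hᴴ = H) (t : ℝ) :
    (NormedSpace.exp ((-Complex.I * (t : ℂ)) • H))ᴴ * NormedSpace.exp ((-Complex.I * (t : ℂ)) • H)
      = 1 := by
  have := exp_add_conj (A := (1 : Op V)) (M := 0) (Commute.zero_left _)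
    (conjTranspose_smul_eq_neg hH t) (Commute.one_left _)
  simpa using this

theorem conjTranspose_maxCutHamiltonian (w : G.edgeSet → ℝ) :
    (maxCutHamiltonian G w)ᴴ = maxCutHamiltonian G w := by
  rw [maxCutHamiltonian_eq_diagonal, Matrix.diagonal_conjTranspose]
  congr 1
  ext z
  simp

theorem conjTranspose_mixer : (mixer V)ᴴ = mixer V := by
  rw [mixer, Matrix.conjTranspose_sum]
  exact Finset.sum_congr rfl fun v _ => conjTranspose_pauliX v

theorem star_state_dotProduct_state (w : G.edgeSet → ℝ) (p : ℕ) (γ β : Fin p → ℝ) :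
    star (state G w p γ β) ⬝ᵥ state G w p γ β = 1 := by
  induction p with
  | zero =>
    have h : (0 : ℝ) < Fintype.card (Config V) := by exact_mod_cast Fintype.card_pos
    simp only [state, plusState, dotProduct, Pi.star_apply, Complex.star_def, Complex.conj_ofReal,
      Finset.sum_const, Finset.card_univ, nsmul_eq_mul]
    norm_cast
    rw [div_mul_div_comm, Real.mul_self_sqrt h.le]
    field_simp
  | succ p ih =>
    have h1 := dotProduct_conj
      (NormedSpace.exp ((-Complex.I * (β (Fin.last p) : ℂ)) • mixer V)) 1
      (NormedSpace.exp ((-Complex.I * (γ (Fin.last p) : ℂ)) • maxCutHamiltonian G w) *ᵥ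
        state G w p (Fin.init γ) (Fin.init β))
    have h2 := dotProduct_conj
      (NormedSpace.exp ((-Complex.I * (γ (Fin.last p) : ℂ)) • maxCutHamiltonian G w)) 1
      (state G w p (Fin.init γ) (Fin.init β))
    rw [Matrix.one_mulVec, mul_one, conjTranspose_exp_mul_exp conjTranspose_mixer,
      Matrix.one_mulVec] at h1
    rw [Matrix.one_mulVec, mul_one,
      conjTranspose_exp_mul_exp (conjTranspose_maxCutHamiltonian G w), Matrix.one_mulVec] at h2
    rw [state, h1, h2, ih]

theorem energy_eq_sum (w : G.edgeSet → ℝ) {p : ℕ} (γ β : Fin p → ℝ) :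
    energy G w γ β =
      ∑ e : G.edgeSet, (w e - w e * expect G w γ β (pauliZZ (e : Sym2 V))) / 2 := by
  have h := star_state_dotProduct_state G w p γ β
  rw [energy, expect, maxCutHamiltonian, Matrix.smul_mulVec, Matrix.sum_mulVec, dotProduct_smul,
    dotProduct_sum, Finset.smul_sum, Complex.re_sum]
  refine Finset.sum_congr rfl fun e _ => ?_
  rw [Matrix.smul_mulVec, Matrix.sub_mulVec, Matrix.one_mulVec, dotProduct_smul, dotProduct_sub, h,
    expect]
  generalize star (state G w p γ β) ⬝ᵥ pauliZZ (e : Sym2 V) *ᵥ state G w p γ β = c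
  simp [Complex.mul_re, Complex.sub_re]
  ring

variable {law : Measure ℝ} [IsProbabilityMeasure law]

theorem integrable_weight {V : Type u} [Fintype V] (G : SimpleGraph V)
    [DecidableRel G.Adj] (hlaw : Integrable (fun x : ℝ => x) law) (e : G.edgeSet) :
    Integrable (fun w : G.edgeSet → ℝ => w e) (weightLaw G law) :=
  integrable_comp_eval (μ := fun _ : G.edgeSet => law) (i := e) hlaw

theorem integral_weight {V : Type u} [Fintype V] (G : SimpleGraph V)
    [DecidableRel G.Adj] (e : G.edgeSet) :
    ∫ w, w e ∂(weightLaw G law) = ∫ x, x ∂law :=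
  integral_comp_eval (μ := fun _ : G.edgeSet => law) (i := e) (f := fun x : ℝ => x)
    aestronglyMeasurable_id

/-- By linearity the energy is a sum over edges with the same expectation for each, so the number of
edges cancels in the cut fraction. -/
theorem theta_eq (hlaw : Integrable (fun x : ℝ => x) law) (hμ : ∫ x, x ∂law ≠ 0) {p : ℕ}
    (S : MarkedGraph.{u} p) (γ β : Fin p → ℝ) :
    Integrable (fun w => energy S.G w γ β) (weightLaw S.G law) ∧
      thetaEdge law S γ β =
        -(√(S.D : ℝ) / (2 * ∫ x, x ∂law)) * (treeCorrelation law S.D γ β).re ∧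
      theta law S γ β = thetaEdge law S γ β := by
  have hw := fun e => weight_mul_expect S.G hlaw S.regular S.girth_gt γ β e
  have hE : thetaEdge law S γ β =
        -(√(S.D : ℝ) / (2 * ∫ x, x ∂law)) * (treeCorrelation law S.D γ β).re := by
    rw [thetaEdge, (hw S.edge).2]
  have hint : ∀ e : S.G.edgeSet, Integrable (fun w : S.G.edgeSet → ℝ =>
      (w e - w e * expect S.G w γ β (pauliZZ (e : Sym2 S.V))) / 2) (weightLaw S.G law) :=
    fun e => ((integrable_weight S.G hlaw e).sub (hw e).1).div_const 2
  refine ⟨?_, hE, ?_⟩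
  · simp only [energy_eq_sum]
    exact integrable_finsetSum _ fun e _ => hint e
  · have hcard : (Fintype.card S.G.edgeSet : ℝ) ≠ 0 := by
      have : Nonempty S.G.edgeSet := ⟨S.edge⟩
      exact_mod_cast Fintype.card_ne_zero
    have hnum : ∫ w, energy S.G w γ β ∂(weightLaw S.G law) = Fintype.card S.G.edgeSet *
        ((∫ x, x ∂law - (treeCorrelation law S.D γ β).re) / 2) := by
      simp only [energy_eq_sum]
      rw [integral_finsetSum _ fun e _ => hint e]
      rw [Finset.sum_congr rfl (g := fun _ => (∫ x, x ∂law - (treeCorrelation law S.D γ β).re) / 2),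
        Finset.sum_const, Finset.card_univ, nsmul_eq_mul]
      intro e _
      rw [integral_div, integral_sub (integrable_weight S.G hlaw e) (hw e).1, integral_weight,
        ← (hw e).2, edgeCorrelation]
    have hden : ∫ w, ∑ e : S.G.edgeSet, w e ∂(weightLaw S.G law) =
        Fintype.card S.G.edgeSet * ∫ x, x ∂law := by
      rw [integral_finsetSum _ fun e _ => integrable_weight S.G hlaw e]
      simp only [integral_weight, Finset.sum_const, Finset.card_univ, nsmul_eq_mul]
    rw [theta, cutFraction, hnum, hden, hE]
    field_simp
    ring

/-- Unit weights are i.i.d. weights with law `δ_1`, whose mean is 1. -/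
theorem nuEdge_eq_thetaEdge {p : ℕ} (S : MarkedGraph.{u} p) (γ β : Fin p → ℝ) :
    nuEdge S γ β = thetaEdge (Measure.dirac 1) S γ β := by
  have h : weightLaw S.G (Measure.dirac 1) = Measure.dirac fun _ => 1 := by
    refine Measure.pi_eq fun s hs => ?_
    rw [Measure.dirac_apply' _ (MeasurableSet.univ_pi hs)]
    simp only [Measure.dirac_apply' _ (hs _)]
    by_cases hmem : ∀ i, (1 : ℝ) ∈ s i
    · simp [Set.indicator, hmem]
    · rw [Set.indicator_of_notMem (by simpa using hmem)]
      push Not at hmem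
      obtain ⟨i, hi⟩ := hmem
      exact (Finset.prod_eq_zero (Finset.mem_univ i) (by simp [hi])).symm
  rw [nuEdge, thetaEdge, edgeCorrelation, h, integral_dirac, integral_dirac]
  simp

end Energy

/-! ### Infinite-degree limit and scaling -/

section Limits

theorem sqrt_mul_sin_div_sqrt (c : ℝ) {D : ℕ} (hD : D ≠ 0) :
    √(D : ℝ) * Real.sin (c / √(D : ℝ)) = c * Real.sinc (c / √(D : ℝ)) := by
  have h : √(D : ℝ) ≠ 0 := by positivity
  by_cases hc : c = 0
  · simp [hc]
  · rw [Real.sinc_of_ne_zero (div_ne_zero hc h)]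
    field_simp

theorem abs_sqrt_mul_sin_le (c : ℝ) (D : ℕ) : |√(D : ℝ) * Real.sin (c / √(D : ℝ))| ≤ |c| := by
  by_cases hD : D = 0
  · simp [hD]
  · rw [sqrt_mul_sin_div_sqrt c hD, abs_mul]
    exact mul_le_of_le_one_right (abs_nonneg _) (Real.abs_sinc_le_one _)

theorem tendsto_const_div_sqrt (c : ℝ) :
    Tendsto (fun D : ℕ => c / √(D : ℝ)) atTop (𝓝 0) :=
  tendsto_const_nhds.div_atTop (Real.tendsto_sqrt_atTop.comp tendsto_natCast_atTop_atTop)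

theorem tendsto_sqrt_mul_sin (c : ℝ) :
    Tendsto (fun D : ℕ => √(D : ℝ) * Real.sin (c / √(D : ℝ))) atTop (𝓝 c) := by
  have h : Tendsto (fun D : ℕ => c * Real.sinc (c / √(D : ℝ))) atTop (𝓝 (c * Real.sinc 0)) :=
    ((Real.continuous_sinc.tendsto 0).comp (tendsto_const_div_sqrt c)).const_mul c
  rw [Real.sinc_zero, mul_one] at h
  refine h.congr' ?_
  filter_upwards [eventually_ne_atTop 0] with D hD
  exact (sqrt_mul_sin_div_sqrt c hD).symm

variable {law : Measure ℝ} [IsProbabilityMeasure law]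

/-- The even part minus 1 is `-2 E[sin²(wt/(4√D))]`. Times `D`, the integrand is dominated by
`w²t²/8`, so a second moment suffices. -/
theorem tendsto_even_phaseAverage (hlaw : MemLp (fun x : ℝ => x) 2 law) (t : ℝ) :
    Tendsto (fun D : ℕ => (D : ℂ) * ((phaseAverage law (t / √(D : ℝ)) +
        phaseAverage law (-(t / √(D : ℝ)))) / 2 - 1)) atTop
      (𝓝 ((-(∫ x, x ^ 2 ∂law) * t ^ 2 / 8 : ℝ) : ℂ)) := by
  have hsq : Integrable (fun x : ℝ => x ^ 2) law := hlaw.integrable_sq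
  have h1 : ∀ D : ℕ, (D : ℂ) * ((phaseAverage law (t / √(D : ℝ)) +
      phaseAverage law (-(t / √(D : ℝ)))) / 2 - 1) =
      ((∫ x, -2 * (√(D : ℝ) * Real.sin (x * t / 4 / √(D : ℝ))) ^ 2 ∂law : ℝ) : ℂ) := by
    intro D
    have hone : (1 : ℂ) = ∫ _x : ℝ, (1 : ℂ) ∂law := by simp
    have hint : Integrable (fun x : ℝ => (Complex.exp (Complex.I * (x / 2 * (t / √(D : ℝ)) : ℝ)) +
        Complex.exp (Complex.I * (x / 2 * (-(t / √(D : ℝ))) : ℝ))) / 2) law :=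
      ((integrable_phase _).add (integrable_phase _)).div_const 2
    rw [hone, phaseAverage, phaseAverage,
      ← integral_add (integrable_phase _) (integrable_phase _), ← integral_div,
      ← integral_sub hint (integrable_const _), ← integral_const_mul, ← integral_complex_ofReal]
    congr 1
    ext x
    have hcos : Real.cos (x / 2 * (t / √(D : ℝ))) =
        1 - 2 * Real.sin (x * t / 4 / √(D : ℝ)) ^ 2 := by
      have : x / 2 * (t / √(D : ℝ)) = 2 * (x * t / 4 / √(D : ℝ)) := by ring
      rw [this, Real.cos_two_mul, Real.cos_sq']
      ring
    have hD : (√(D : ℝ)) ^ 2 = D := Real.sq_sqrt (Nat.cast_nonneg D)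
    have hexp : (Complex.exp (Complex.I * (x / 2 * (t / √(D : ℝ)) : ℝ)) +
        Complex.exp (Complex.I * (x / 2 * (-(t / √(D : ℝ))) : ℝ))) / 2 =
        (Real.cos (x / 2 * (t / √(D : ℝ))) : ℝ) := by
      rw [Complex.ofReal_cos, Complex.cos]
      congr 3
      · rw [mul_comm]
      · push_cast
        ring
    rw [hexp, hcos, mul_pow, hD]
    push_cast
    ring
  simp only [h1]
  refine (Complex.continuous_ofReal.tendsto _).comp ?_
  have h2 : -(∫ x, x ^ 2 ∂law) * t ^ 2 / 8 = ∫ x, -2 * (x * t / 4) ^ 2 ∂law := by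
    have : ∀ x : ℝ, -2 * (x * t / 4) ^ 2 = x ^ 2 * (-(t ^ 2 / 8)) := fun x => by ring
    simp only [this]
    rw [integral_mul_const]
    ring
  rw [h2]
  refine tendsto_integral_of_dominated_convergence (fun x => 2 * (x * t / 4) ^ 2) ?_ ?_ ?_ ?_
  · intro D
    exact (by fun_prop : Continuous fun x : ℝ =>
      -2 * (√(D : ℝ) * Real.sin (x * t / 4 / √(D : ℝ))) ^ 2).aestronglyMeasurable
  · have : ∀ x : ℝ, 2 * (x * t / 4) ^ 2 = x ^ 2 * (t ^ 2 / 8) := fun x => by ring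
    simp only [this]
    exact hsq.mul_const _
  · intro D
    refine ae_of_all _ fun x => ?_
    rw [Real.norm_eq_abs, abs_mul, abs_neg, abs_two, abs_of_nonneg (sq_nonneg _)]
    exact mul_le_mul_of_nonneg_left (sq_le_sq.2 (abs_sqrt_mul_sin_le _ _)) zero_le_two
  · exact ae_of_all _ fun x => ((tendsto_sqrt_mul_sin _).pow 2).const_mul _

/-- The odd part is `i E[w sin(wt/(2√D))]`. Times `√D`, its integrand is dominated by `w²|t|/2`. -/
theorem tendsto_odd_weightedPhaseAverage (hlaw : MemLp (fun x : ℝ => x) 2 law) (t : ℝ) :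
    Tendsto (fun D : ℕ => (√(D : ℝ) : ℂ) * ((weightedPhaseAverage law (t / √(D : ℝ)) -
        weightedPhaseAverage law (-(t / √(D : ℝ)))) / 2)) atTop
      (𝓝 (Complex.I * (((∫ x, x ^ 2 ∂law) * t / 2 : ℝ) : ℂ))) := by
  have hsq : Integrable (fun x : ℝ => x ^ 2) law := hlaw.integrable_sq
  have hlaw' : Integrable (fun x : ℝ => x) law := hlaw.integrable one_le_two
  have h1 : ∀ D : ℕ, (√(D : ℝ) : ℂ) * ((weightedPhaseAverage law (t / √(D : ℝ)) -
      weightedPhaseAverage law (-(t / √(D : ℝ)))) / 2) =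
      Complex.I * ((∫ x, x * (√(D : ℝ) * Real.sin (x * t / 2 / √(D : ℝ))) ∂law : ℝ) : ℂ) := by
    intro D
    rw [weightedPhaseAverage, weightedPhaseAverage,
      ← integral_sub (integrable_weightedPhase hlaw' _) (integrable_weightedPhase hlaw' _),
      ← integral_div, ← integral_const_mul, ← integral_complex_ofReal, ← integral_const_mul]
    congr 1
    ext x
    have hexp : (Complex.exp (Complex.I * (x / 2 * (t / √(D : ℝ)) : ℝ)) -
        Complex.exp (Complex.I * (x / 2 * (-(t / √(D : ℝ))) : ℝ))) / 2 =
        Complex.I * (Real.sin (x * t / 2 / √(D : ℝ)) : ℝ) := by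
      have h2 : x / 2 * (t / √(D : ℝ)) = x * t / 2 / √(D : ℝ) := by ring
      have h3 : x / 2 * (-(t / √(D : ℝ))) = -(x * t / 2 / √(D : ℝ)) := by ring
      rw [Complex.ofReal_sin, Complex.sin, h2, h3]
      push_cast
      rw [mul_comm Complex.I, mul_comm Complex.I]
      linear_combination (Complex.exp (-(x * t / 2 / (√(D : ℝ) : ℂ)) * Complex.I) -
        Complex.exp ((x * t / 2 / (√(D : ℝ) : ℂ)) * Complex.I)) / 2 * (-Complex.I_sq)
    rw [← mul_sub, mul_div_assoc, hexp]
    push_cast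
    ring
  simp only [h1]
  refine Tendsto.const_mul _ ((Complex.continuous_ofReal.tendsto _).comp ?_)
  have h2 : (∫ x, x ^ 2 ∂law) * t / 2 = ∫ x, x * (x * t / 2) ∂law := by
    have : ∀ x : ℝ, x * (x * t / 2) = x ^ 2 * (t / 2) := fun x => by ring
    simp only [this]
    rw [integral_mul_const]
    ring
  rw [h2]
  refine tendsto_integral_of_dominated_convergence (fun x => |x| * |x * t / 2|) ?_ ?_ ?_ ?_
  · intro D
    exact (by fun_prop : Continuous fun x : ℝ =>
      x * (√(D : ℝ) * Real.sin (x * t / 2 / √(D : ℝ)))).aestronglyMeasurable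
  · have : ∀ x : ℝ, |x| * |x * t / 2| = x ^ 2 * |t / 2| := fun x => by
      rw [mul_div_assoc, abs_mul, ← mul_assoc, abs_mul_abs_self, sq]
    simp only [this]
    exact hsq.mul_const _
  · intro D
    refine ae_of_all _ fun x => ?_
    rw [Real.norm_eq_abs, abs_mul]
    exact mul_le_mul_of_nonneg_left (abs_sqrt_mul_sin_le _ _) (abs_nonneg _)
  · exact ae_of_all _ fun x => (tendsto_sqrt_mul_sin _).const_mul _

theorem phaseAverage_zero : phaseAverage law 0 = 1 := by
  simp [phaseAverage]

variable {p : ℕ}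

theorem sum_eq_sum_symm (X : Site p → ℂ) : ∑ a, X a = ∑ a, (X a + X (-a)) / 2 := by
  have h : ∑ a, X (-a) = ∑ a, X a := Equiv.sum_comp (Equiv.neg (Site p)) X
  rw [← Finset.sum_div, Finset.sum_add_distrib, h]
  ring

theorem sitePhase_neg_right (γ : Fin p → ℝ) (a b : Site p) :
    sitePhase γ a (-b) = -sitePhase γ a b := by
  rw [sitePhase_comm, sitePhase_neg_left, sitePhase_comm]

section Branch

variable (γ β : Fin p → ℝ) (g : ℝ → ℂ) (D : ℕ)

theorem branch_neg (m : ℕ) (a : Site p) :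
    branch (siteWeight β) (fun b a => g (sitePhase γ b a)) D m (-a) =
      branch (siteWeight β) (fun b a => g (sitePhase γ b a)) D m a := by
  induction m generalizing a with
  | zero => rfl
  | succ m ih =>
    rw [branch, branch]
    congr 1
    rw [← Equiv.sum_comp (Equiv.neg (Site p))]
    refine Finset.sum_congr rfl fun b _ => ?_
    rw [Equiv.neg_apply, siteWeight_neg, ih, sitePhase_neg_left, sitePhase_neg_right, neg_neg]

theorem exists_isCausal_branch (hg : g 0 = 1) (m : ℕ) :
    ∃ h, IsCausal p h ∧ ∀ a : Site p,
      branch (siteWeight β) (fun b a => g (sitePhase γ b a)) D m a = h a.1 a.2.1 := by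
  induction m with
  | zero => exact ⟨_, isCausal_one p, fun _ => rfl⟩
  | succ m ih =>
    obtain ⟨h, hc, he⟩ := ih
    refine ⟨_, (hc.transfer γ β g hg 1).pow D, fun a => ?_⟩
    rw [branch]
    congr 1
    refine Finset.sum_congr rfl fun b _ => ?_
    rw [he, sitePhase_comm]
    rfl

/-- This exact normalization at finite `D` supplies the leading 1 in `(1 + x_D)^D`; without it the
powers need not converge. -/
theorem sum_siteWeight_mul_branch (hg : g 0 = 1) (m : ℕ) :
    ∑ b, siteWeight β b * branch (siteWeight β) (fun b a => g (sitePhase γ b a)) D m b = 1 := by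
  obtain ⟨h, hc, he⟩ := exists_isCausal_branch γ β g D hg m
  simp only [he]
  exact hc.sum_siteWeight β

end Branch

/-- The limit of the weight of the branches of depth `m` as the degree tends to infinity. -/
def limitBranch (κ : ℝ) (γ β : Fin p → ℝ) : ℕ → Site p → ℂ
  | 0, _ => 1
  | m + 1, a => Complex.exp (∑ b, siteWeight β b * limitBranch κ γ β m b *
      ((-κ * sitePhase γ b a ^ 2 / 8 : ℝ) : ℂ))

theorem tendsto_branch (hlaw : MemLp (fun x : ℝ => x) 2 law) (γ β : Fin p → ℝ) (m : ℕ)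
    (a : Site p) :
    Tendsto (fun D : ℕ => branch (siteWeight β)
        (fun b a => phaseAverage law (sitePhase (fun r => γ r / √(D : ℝ)) b a)) D m a) atTop
      (𝓝 (limitBranch (∫ x, x ^ 2 ∂law) γ β m a)) := by
  induction m generalizing a with
  | zero => exact tendsto_const_nhds
  | succ m ih =>
    set B : ℕ → Site p → ℂ := fun D => branch (siteWeight β)
        (fun b a => phaseAverage law (sitePhase (fun r => γ r / √(D : ℝ)) b a)) D m with hB
    have h1 : ∀ D : ℕ, ∑ b, siteWeight β b * (B D b *
        phaseAverage law (sitePhase (fun r => γ r / √(D : ℝ)) b a)) =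
        1 + ∑ b, siteWeight β b * B D b * ((phaseAverage law (sitePhase γ b a / √(D : ℝ)) +
          phaseAverage law (-(sitePhase γ b a / √(D : ℝ)))) / 2 - 1) := by
      intro D
      -- Subtracting the normalization and symmetrizing under `b ↦ -b` leaves only the even part of
      -- the phase average, of order `1/D`.
      have hone := sum_siteWeight_mul_branch (fun r => γ r / √(D : ℝ)) β (phaseAverage law) D
        phaseAverage_zero m
      refine Eq.trans ?_ (congrArg (· + _) hone)
      rw [← Finset.sum_add_distrib, sum_eq_sum_symm]
      refine Finset.sum_congr rfl fun b _ => ?_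
      have hn : B D (-b) = B D b := branch_neg _ _ _ _ _ _
      rw [siteWeight_neg, hn, sitePhase_neg_left, sitePhase_div]
      simp only [hB]
      ring
    have h2 : ∀ D : ℕ, branch (siteWeight β)
        (fun b a => phaseAverage law (sitePhase (fun r => γ r / √(D : ℝ)) b a)) D (m + 1) a =
        (1 + ∑ b, siteWeight β b * B D b * ((phaseAverage law (sitePhase γ b a / √(D : ℝ)) +
          phaseAverage law (-(sitePhase γ b a / √(D : ℝ)))) / 2 - 1)) ^ D := by
      intro D
      rw [branch, ← h1]
    simp only [h2]
    refine Complex.tendsto_one_add_pow_exp_of_tendsto ?_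
    simp only [Finset.mul_sum]
    refine tendsto_finsetSum _ fun b _ => ?_
    have := ((ih b).const_mul (siteWeight β b)).mul
      (tendsto_even_phaseAverage hlaw (sitePhase γ b a))
    refine this.congr fun D => ?_
    simp only [hB]
    ring

/-- The limit of `√D` times the tree correlation, divided by the second moment of the weights. -/
def limitCorrelation (κ : ℝ) (γ β : Fin p → ℝ) : ℂ :=
  ∑ a, ∑ b, siteWeight β a * (siteWeight β b *
    (limitBranch κ γ β p a * limitBranch κ γ β p b *
      (Complex.I * ((sitePhase γ a b / 2 : ℝ) : ℂ) * ((a.2.2 * b.2.2 : ℤˣ) : ℤ))))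

/-- Under `a ↦ -a` the weight and the branches are even while the observed spin product is odd, so
only the odd part of the central average survives. It has order `1/√D`, matching the prefactor. -/
theorem tendsto_treeCorrelation (hlaw : MemLp (fun x : ℝ => x) 2 law) (γ β : Fin p → ℝ) :
    Tendsto (fun D : ℕ => (√(D : ℝ) : ℂ) * treeCorrelation law D (fun r => γ r / √(D : ℝ)) β) atTop
      (𝓝 (((∫ x, x ^ 2 ∂law : ℝ) : ℂ) * limitCorrelation (∫ x, x ^ 2 ∂law) γ β)) := by
  set B : ℕ → Site p → ℂ := fun D => branch (siteWeight β)
      (fun b a => phaseAverage law (sitePhase (fun r => γ r / √(D : ℝ)) b a)) D p with hB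
  have h1 : ∀ D : ℕ, (√(D : ℝ) : ℂ) * treeCorrelation law D (fun r => γ r / √(D : ℝ)) β =
      ∑ a, ∑ b, siteWeight β a * siteWeight β b * (B D a * B D b) *
        ((√(D : ℝ) : ℂ) * ((weightedPhaseAverage law (sitePhase γ a b / √(D : ℝ)) -
          weightedPhaseAverage law (-(sitePhase γ a b / √(D : ℝ)))) / 2)) *
        ((a.2.2 * b.2.2 : ℤˣ) : ℤ) := by
    intro D
    rw [treeCorrelation, sum_eq_sum_symm, Finset.mul_sum]
    refine Finset.sum_congr rfl fun a _ => ?_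
    rw [← Finset.sum_add_distrib, Finset.sum_div, Finset.mul_sum]
    refine Finset.sum_congr rfl fun b _ => ?_
    have hn : B D (-a) = B D a := branch_neg _ _ _ _ _ _
    simp only [hB] at hn
    rw [siteWeight_neg, hn, sitePhase_neg_left, sitePhase_div]
    simp only [hB, Prod.snd_neg, neg_mul, Units.val_neg, Int.cast_neg]
    ring
  simp only [h1, limitCorrelation, Finset.mul_sum]
  refine tendsto_finsetSum _ fun a _ => tendsto_finsetSum _ fun b _ => ?_
  have := ((((tendsto_branch hlaw γ β p a).mul (tendsto_branch hlaw γ β p b)).const_mul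
    (siteWeight β a * siteWeight β b)).mul
      (tendsto_odd_weightedPhaseAverage hlaw (sitePhase γ a b))).mul_const
      (((a.2.2 * b.2.2 : ℤˣ) : ℤ) : ℂ)
  convert this using 2
  push_cast
  ring

/-- In the exponents `κ` multiplies a squared phase, which is quadratic in `γ`. -/
theorem limitBranch_scale {κ : ℝ} (hκ : 0 < κ) (γ β : Fin p → ℝ) (m : ℕ) (a : Site p) :
    limitBranch κ (fun r => γ r / √κ) β m a = limitBranch 1 γ β m a := by
  induction m generalizing a with
  | zero => rfl
  | succ m ih =>
    rw [limitBranch, limitBranch]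
    congr 1
    refine Finset.sum_congr rfl fun b _ => ?_
    rw [ih, sitePhase_div, div_pow, Real.sq_sqrt hκ.le]
    congr 2
    field_simp

/-- The one remaining dependence on `γ` is the linear factor of the central edge, whence `1/√κ`. -/
theorem limitCorrelation_scale {κ : ℝ} (hκ : 0 < κ) (γ β : Fin p → ℝ) :
    limitCorrelation κ (fun r => γ r / √κ) β = limitCorrelation 1 γ β / (√κ : ℝ) := by
  rw [limitCorrelation, limitCorrelation, Finset.sum_div]
  refine Finset.sum_congr rfl fun a _ => ?_
  rw [Finset.sum_div]
  refine Finset.sum_congr rfl fun b _ => ?_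
  rw [limitBranch_scale hκ, limitBranch_scale hκ, sitePhase_div]
  push_cast
  ring

theorem isWeightedLimit (hlaw : MemLp (fun x : ℝ => x) 2 law) (hμ : ∫ x, x ∂law ≠ 0) (p : ℕ) :
    IsWeightedLimit.{u} law p fun γ β => -((∫ x, x ^ 2 ∂law) / (2 * ∫ x, x ∂law)) *
      (limitCorrelation (∫ x, x ^ 2 ∂law) γ β).re := by
  have hlaw' : Integrable (fun x : ℝ => x) law := hlaw.integrable one_le_two
  refine ⟨fun S γ β => ⟨(theta_eq hlaw' hμ S γ β).1,
    (weight_mul_expect S.G hlaw' S.regular S.girth_gt γ β S.edge).1⟩, fun γ β => ?_⟩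
  have h1 : Tendsto (fun D : ℕ => -(√(D : ℝ) / (2 * ∫ x, x ∂law)) *
      (treeCorrelation law D (fun r => γ r / √(D : ℝ)) β).re) atTop
      (𝓝 (-((∫ x, x ^ 2 ∂law) / (2 * ∫ x, x ∂law)) *
        (limitCorrelation (∫ x, x ^ 2 ∂law) γ β).re)) := by
    have := ((Complex.continuous_re.tendsto _).comp
      (tendsto_treeCorrelation hlaw γ β)).const_mul (-(1 / (2 * ∫ x, x ∂law)))
    rw [Complex.re_ofReal_mul] at this
    convert this using 2 with D
    · rw [Function.comp_apply, Complex.re_ofReal_mul]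
      ring
    · ring
  have h2 : Tendsto (fun S : MarkedGraph.{u} p =>
      thetaEdge law S (fun r => γ r / √(S.D : ℝ)) β) (degreeToInfinity p)
      (𝓝 (-((∫ x, x ^ 2 ∂law) / (2 * ∫ x, x ∂law)) *
        (limitCorrelation (∫ x, x ^ 2 ∂law) γ β).re)) := by
    -- The edge quantity is a function of `S.D` alone, so a limit along `ℕ` is already uniform over
    -- all marked graphs.
    refine (h1.comp (tendsto_comap : Tendsto (fun S : MarkedGraph.{u} p => S.D) _ _)).congr ?_
    intro S
    exact (theta_eq hlaw' hμ S _ β).2.1.symm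
  exact ⟨h2.congr fun S => (theta_eq hlaw' hμ S _ β).2.2.symm, h2⟩

theorem isUnweightedLimit (p : ℕ) :
    IsUnweightedLimit.{u} p fun γ β => -(1 / 2) * (limitCorrelation 1 γ β).re := by
  intro γ β
  have hμ : ∫ x : ℝ, x ∂(Measure.dirac (1 : ℝ)) = 1 := integral_dirac _ _
  have hκ : ∫ x : ℝ, x ^ 2 ∂(Measure.dirac (1 : ℝ)) = 1 := by
    rw [integral_dirac (fun x : ℝ => x ^ 2), one_pow]
  have hlaw : MemLp (fun x : ℝ => x) 2 (Measure.dirac (1 : ℝ)) := by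
    refine (memLp_const (1 : ℝ)).ae_eq ?_
    rw [Filter.EventuallyEq, ae_dirac_eq]
    rfl
  have h := ((isWeightedLimit.{u} hlaw (by rw [hμ]; exact one_ne_zero) p).2 γ β).2
  simp only [hμ, hκ, mul_one] at h
  exact h.congr fun S => (nuEdge_eq_thetaEdge S _ β).symm

end Limits

end

end QAOA

theorem theorem3 (p : ℕ) :
    ∃ ν : (Fin p → ℝ) → (Fin p → ℝ) → ℝ,
      QAOA.IsUnweightedLimit.{u} p ν ∧
      ∀ (law : MeasureTheory.Measure ℝ) [MeasureTheory.IsProbabilityMeasure law],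
        MeasureTheory.MemLp (fun x : ℝ => x) 2 law →
        (∫ x, x ∂law) ≠ 0 →
        ∃ ϑ : (Fin p → ℝ) → (Fin p → ℝ) → ℝ,
          QAOA.IsWeightedLimit.{u} law p ϑ ∧
          ∀ γ β : Fin p → ℝ,
            ν γ β = (∫ x, x ∂law) / √(∫ x, x ^ 2 ∂law) *
              ϑ (fun r => γ r / √(∫ x, x ^ 2 ∂law)) β := by
  refine ⟨_, QAOA.isUnweightedLimit p, fun law _ hlaw hμ =>
    ⟨_, QAOA.isWeightedLimit hlaw hμ p, fun γ β => ?_⟩⟩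
  have hsq : Integrable (fun x : ℝ => x ^ 2) law := hlaw.integrable_sq
  -- A vanishing second moment would make the weight zero almost surely, contradicting the nonzero
  -- mean.
  have hκ : 0 < ∫ x, x ^ 2 ∂law := by
    refine lt_of_le_of_ne (integral_nonneg fun x => sq_nonneg x) fun h => hμ ?_
    have h0 := (integral_eq_zero_iff_of_nonneg (fun x => sq_nonneg x) hsq).1 h.symm
    refine integral_eq_zero_of_ae ?_
    filter_upwards [h0] with x hx
    exact pow_eq_zero_iff two_ne_zero |>.1 hx
  have hsqrt : √(∫ x, x ^ 2 ∂law) ≠ 0 := (Real.sqrt_pos.2 hκ).ne'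
  have hmul : √(∫ x, x ^ 2 ∂law) ^ 2 = ∫ x, x ^ 2 ∂law := Real.sq_sqrt hκ.le
  -- What remains is `(μ/√κ) · (κ/(2μ)) · (1/√κ) = 1/2`.
  rw [QAOA.limitCorrelation_scale hκ, Complex.div_ofReal_re]
  generalize (∫ x, x ^ 2 ∂law) = κ at *
  field_simp
  rw [hmul]
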